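/- **Theorem (initial conditions without asymptotic velocities).** Let $n,d\in\mathbb N$ and consider $n$ particles in $\mathbb R^d$ with masses $m_i>0$. Put $M=(\mathbb R^d)^n$, $\Delta=\{q\in M: q_i=q_j\text{ for some }i\ne j\}$, and let the phase space be $P=T^*(M\setminus\Delta)$. Let $$H(p,q)=\sum_{i=1}^n\frac{\|p_i\|^2}{2m_i}+V(q),\qquad V(q)=\sum_{1\le i<j\le n}V_{i,j}(q_i-q_j),$$ where the $V_{i,j}\in C^2(\mathbb R^d\setminus\{0\},\mathbb R)$ are *long-ranged*, that is, for some $\varepsilon>0$ and $I>0$ $$|\partial_\beta V_{i,j}(q)|\le I\,\|q\|^{-\varepsilon-|\beta|}\qquad(|\beta|\le 2,\ \|q\|\ge 1,\ i<j).\tag{LR}$$ Let $\Phi$ be the maximal Hamiltonian flow on $P$, with domain $D=\{(t,x): T^-(x)<t<T^+(x)\}$ and escape times $T=T^+$ and $T^-$; write $q(t,x)$ for the positions at time $t$. Let $J(q)=\frac12\sum_i m_i\|q_i\|^2$ and $\|q\|_{\mathcal M}=(2J(q))^{1/2}$. Let $$\mathrm{NAV}=\Big\{x\in P:\ \lim_{t\nearrow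 T(x)} q(t,x)/t\ \text{ does not exist in } M\Big\}.$$ Let $\mathrm{Wand}$ be the set of $x\in P$ having a neighbourhood $U_x\subseteq P$ and a time $t_x\in(0,T^+(x))$ with $U_x\cap\Phi\big(((t_x,T^+(x))\times U_x)\cap D\big)=\emptyset$. For a set partition $\mathcal C$ of $\{1,\dots,n\}$ into $|\mathcal C|$ blocks, let $q^E_{\mathcal C}\in M$ be obtained from $q$ by moving each particle to the barycenter of the block containing it. For $\delta>0$ put $$J^{(\delta)}(q)=\max_{\mathcal C}\big(J(q^E_{\mathcal C})+\delta^{|\mathcal C|}\big),\qquad \Xi^{(\delta)}_{\mathcal C}=\{q\in M: J(q^E_{\mathcal C})+\delta^{|\mathcal C|}=J^{(\delta)}(q)\}.$$ For $\varepsilon>0$ and $x\in P$, a *cluster function* of $x$ is a map $\mathcal A$ from $(0,T(x))$ to the set partitions such that $q(t,x)/t^{1-\varepsilon/2}\in\Xi^{(\delta)}_{\mathcal A(t)}$ for all $t$. Then: 1. There is $\delta_0\in(0,1]$ such that for every $\delta\in(0,\delta_0]$, every $\varepsilon>0$ for which (LR) holds with some $I>0$, every $x\in\mathrm{NAV}$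 and every cluster function $\mathcal A$ of $x$, the cluster-external speed satisfies $$\lim_{t\nearrow T(x)}\Big\|\tfrac{d}{dt}q^E_{\mathcal A(t)}(t,x)\Big\|_{\mathcal M}=\infty ,$$ where $\mathcal A(t)$ is held fixed in the differentiation. Moreover $\lim_{t\nearrow T(x)}V(q(t,x))=-\infty$ for every $x\in\mathrm{NAV}$. 2. The limit $j^+(x)=\lim_{t\nearrow T(x)}J(q(t,x)/t)$ exists in $[0,\infty]$ for every $x\in P$, and $j^+:P\to[0,\infty]$ is continuous at every point of $\mathrm{NAV}$, where $[0,\infty]$ is the one-point compactification of $[0,\infty)$. 3. $\mathrm{NAV}\subseteq\mathrm{Wand}$, and $\mathrm{NAV}$ is a Borel subset of $P$. -/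

import Mathlib

open Set Filter Topology

noncomputable section

namespace NBody

/-- The joint configuration space `M = ⊕ᵢ ℝᵈ` of `n` particles in `d` dimensions. -/
abbrev Config (n d : ℕ) : Type := Fin n → EuclideanSpace ℝ (Fin d)

/-- The space `T*M` of pairs `(p, q)`: momenta first, positions second. -/
abbrev Phase (n d : ℕ) : Type := Config n d × Config n d

/-- A family of pair potentials; only the entries `V i j` with `i < j` are ever used. -/
abbrev PairPotential (n d : ℕ) : Type := Fin n → Fin n → EuclideanSpace ℝ (Fin d) → ℝ

variable {n d : ℕ}

/-- The partial derivatives `∂_β V_{i,j}` of order `|β| = k ≤ 2` are bounded by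
`I ‖q‖^(-ε-k)` for `‖q‖ ≥ 1`. The tuple `b` lists the coordinates in which one differentiates. -/
def LongRangeBound (V : PairPotential n d) (ε I : ℝ) : Prop :=
  ∀ i j : Fin n, i < j → ∀ k : ℕ, k ≤ 2 → ∀ b : Fin k → Fin d,
    ∀ q : EuclideanSpace ℝ (Fin d), 1 ≤ ‖q‖ →
      |iteratedFDeriv ℝ k (V i j) q (fun l => EuclideanSpace.single (b l) (1 : ℝ))|
        ≤ I * ‖q‖ ^ (-ε - (k : ℝ))

/-- The pair potentials are long-ranged with exponent `ε`. -/
def LongRangedWith (V : PairPotential n d) (ε : ℝ) : Prop :=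
  ∃ I : ℝ, 0 < I ∧ LongRangeBound V ε I

/-- A long-ranged potential: twice continuously differentiable away from the origin, and
long-ranged with some exponent `ε > 0`. -/
structure IsLongRanged (V : PairPotential n d) : Prop where
  contDiffOn : ∀ i j : Fin n, i < j → ContDiffOn ℝ 2 (V i j) {0}ᶜ
  decay : ∃ ε : ℝ, 0 < ε ∧ LongRangedWith V ε

/-- The non-collision configuration space `M \ Δ`. -/
def noncollision (n d : ℕ) : Set (Config n d) := {q | ∀ i j : Fin n, i ≠ j → q i ≠ q j}

/-- The phase space `P = T*(M \ Δ)`, as an (open) subset of `T*M`. -/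
def phaseSpace (n d : ℕ) : Set (Phase n d) := {x | x.2 ∈ noncollision n d}

/-- The potential `V(q) = ∑_{i<j} V_{i,j}(q_i - q_j)`. -/
def potential (V : PairPotential n d) (q : Config n d) : ℝ :=
  ∑ i : Fin n, ∑ j ∈ Finset.Ioi i, V i j (q i - q j)

/-- The force `-∇_{q_i} V(q)` on the `i`-th particle. -/
def force (V : PairPotential n d) (q : Config n d) (i : Fin n) : EuclideanSpace ℝ (Fin d) :=
  (∑ j ∈ Finset.Iio i, gradient (V j i) (q j - q i))
    - ∑ j ∈ Finset.Ioi i, gradient (V i j) (q i - q j)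

/-- The Hamiltonian vector field of `H(p,q) = ∑ ‖p_i‖² / (2 m_i) + V(q)`:
`p_i' = -∇_{q_i} V(q)`, `q_i' = p_i / m_i`. -/
def hamiltonianField (m : Fin n → ℝ) (V : PairPotential n d) (x : Phase n d) : Phase n d :=
  (force V x.2, fun i => (m i)⁻¹ • x.1 i)

/-- `γ` solves Hamilton's equations inside the phase space `P` on the open interval `(a, b)`
containing `0`, with `γ 0 = x`. -/
structure IsTrajectory (m : Fin n → ℝ) (V : PairPotential n d) (x : Phase n d)
    (γ : ℝ → Phase n d) (a b : ℝ) : Prop where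
  zero_mem : (0 : ℝ) ∈ Ioo a b
  initial : γ 0 = x
  mem_phaseSpace : ∀ t ∈ Ioo a b, γ t ∈ phaseSpace n d
  isIntegralCurveOn : IsIntegralCurveOn γ (fun _ => hamiltonianField m V) (Ioo a b)

/-- The maximal interval of existence of the solution with initial condition `x`. -/
def lifetime (m : Fin n → ℝ) (V : PairPotential n d) (x : Phase n d) : Set ℝ :=
  {t | ∃ (γ : ℝ → Phase n d) (a b : ℝ), t ∈ Ioo a b ∧ IsTrajectory m V x γ a b}

open Classical in
/-- The maximal Hamiltonian flow `Φ(t, x)`, meaningful for `t` in the lifetime of `x`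
(solutions being unique, the choice does not matter). -/
def flow (m : Fin n → ℝ) (V : PairPotential n d) (t : ℝ) (x : Phase n d) : Phase n d :=
  if h : t ∈ lifetime m V x then h.choose t else x

/-- The forward escape time `T(x) = T⁺(x)`. -/
def escapeTime (m : Fin n → ℝ) (V : PairPotential n d) (x : Phase n d) : EReal :=
  sSup ((fun t : ℝ => (t : EReal)) '' lifetime m V x)

/-- The backward escape time `T⁻(x)`. -/
def escapeTimeNeg (m : Fin n → ℝ) (V : PairPotential n d) (x : Phase n d) : EReal :=
  sInf ((fun t : ℝ => (t : EReal)) '' lifetime m V x)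

/-- The domain `D` of the maximal flow. -/
def flowDomain (m : Fin n → ℝ) (V : PairPotential n d) : Set (ℝ × Phase n d) :=
  {z | z.2 ∈ phaseSpace n d ∧
    escapeTimeNeg m V z.2 < (z.1 : EReal) ∧ (z.1 : EReal) < escapeTime m V z.2}

/-- The positions `q(t, x)` along the flow line through `x`. -/
def position (m : Fin n → ℝ) (V : PairPotential n d) (x : Phase n d) (t : ℝ) : Config n d :=
  (flow m V t x).2

/-- The filter `t ↗ T(x)` on the real line (for `T(x) = ∞` this is `t → ∞`). -/
def toEscape (m : Fin n → ℝ) (V : PairPotential n d) (x : Phase n d) : Filter ℝ :=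
  comap (fun t : ℝ => (t : EReal)) (𝓝[<] (escapeTime m V x))

/-- The set of initial conditions without asymptotic velocity: `lim_{t ↗ T(x)} q(t,x)/t` does not
exist in `M`. -/
def NAV (m : Fin n → ℝ) (V : PairPotential n d) : Set (Phase n d) :=
  {x | x ∈ phaseSpace n d ∧
    ¬ ∃ v : Config n d, Tendsto (fun t : ℝ => t⁻¹ • position m V x t) (toEscape m V x) (𝓝 v)}

/-- The moment of inertia `J(q) = ½ ∑ m_i ‖q_i‖²`. -/
def inertia (m : Fin n → ℝ) (q : Config n d) : ℝ :=
  (1 / 2) * ∑ i : Fin n, m i * ‖q i‖ ^ 2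

/-- The norm `‖q‖_𝓜 = ⟨q, 𝓜 q⟩^(1/2)` given by the mass matrix. -/
def massNorm (m : Fin n → ℝ) (q : Config n d) : ℝ :=
  Real.sqrt (∑ i : Fin n, m i * ‖q i‖ ^ 2)

/-- `t ↦ J(q(t,x)/t)`, as a function with values in `[0,∞]`. -/
def scaledInertia (m : Fin n → ℝ) (V : PairPotential n d) (x : Phase n d) (t : ℝ) : ENNReal :=
  ENNReal.ofReal (inertia m (t⁻¹ • position m V x t))

/-- `j⁺(x) = lim_{t ↗ T(x)} J(q(t,x)/t) ∈ [0,∞]`. -/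
def jPlus (m : Fin n → ℝ) (V : PairPotential n d) (x : Phase n d) : ENNReal :=
  limUnder (toEscape m V x) (scaledInertia m V x)

/-- The wandering set of the flow. -/
def Wand (m : Fin n → ℝ) (V : PairPotential n d) : Set (Phase n d) :=
  {x | x ∈ phaseSpace n d ∧ ∃ U ∈ 𝓝 x, U ⊆ phaseSpace n d ∧
    ∃ s : ℝ, 0 < s ∧ (s : EReal) < escapeTime m V x ∧
      U ∩ (fun z : ℝ × Phase n d => flow m V z.1 z.2) ''
        (({t : ℝ | s < t ∧ (t : EReal) < escapeTime m V x} ×ˢ U) ∩ flowDomain m V) = ∅}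

/-- Set partitions (cluster decompositions) of the index set of the particles. -/
abbrev Clustering (n : ℕ) : Type := Finpartition (Finset.univ : Finset (Fin n))

/-- The barycenter `q_C` of a set `C` of particles. -/
def barycenter (m : Fin n → ℝ) (C : Finset (Fin n)) (q : Config n d) :
    EuclideanSpace ℝ (Fin d) :=
  (∑ j ∈ C, m j)⁻¹ • ∑ j ∈ C, m j • q j

/-- The cluster-external part `q^E_𝒞 = Π^E_𝒞 q`, where `Π^E_𝒞` is the `𝓜`-orthogonal projection onto
`{q | q_i = q_j if i, j are in the same cluster}`: every particle is moved to the barycenter of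
its cluster. -/
def extProj (m : Fin n → ℝ) (𝒞 : Clustering n) (q : Config n d) : Config n d :=
  fun i => barycenter m (𝒞.part i) q

/-- `J^(δ)(q) = max_𝒞 (J(Π^E_𝒞 q) + δ^|𝒞|)`, the maximum being over the finitely many set
partitions. -/
def inertiaDelta (m : Fin n → ℝ) (δ : ℝ) (q : Config n d) : ℝ :=
  ⨆ 𝒞 : Clustering n, (inertia m (extProj m 𝒞 q) + δ ^ 𝒞.parts.card)

/-- The member `Ξ_𝒞^(δ)` of the Graf partition of `M`. -/
def grafCell (d : ℕ) (m : Fin n → ℝ) (δ : ℝ) (𝒞 : Clustering n) : Set (Config n d) :=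
  {q | inertia m (extProj m 𝒞 q) + δ ^ 𝒞.parts.card = inertiaDelta m δ q}

/-- `A` is a cluster function of the orbit of `x`: `q(t,x) / t^(1-ε/2) ∈ Ξ_{A(t)}^(δ)` for all
`t ∈ (0, T(x))`. -/
def IsClusterFunction (m : Fin n → ℝ) (V : PairPotential n d) (ε δ : ℝ) (x : Phase n d)
    (A : ℝ → Clustering n) : Prop :=
  ∀ t : ℝ, 0 < t → (t : EReal) < escapeTime m V x →
    (t ^ (1 - ε / 2))⁻¹ • position m V x t ∈ grafCell d m δ (A t)

/-- The cluster-external speed `‖d/dt q^E_{A(t)}(t)‖_𝓜`; the cluster decomposition is held fixed in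
the differentiation. -/
def externalSpeed (m : Fin n → ℝ) (V : PairPotential n d) (x : Phase n d)
    (A : ℝ → Clustering n) (t : ℝ) : ℝ :=
  massNorm m (deriv (fun s : ℝ => extProj m (A t) (position m V x s)) t)

end NBody

end

open Set Filter Topology

namespace NBody

variable {n d : ℕ} {m : Fin n → ℝ} {V : PairPotential n d}

/-! For free motion `q(t)/t` is affine in `1/t`, so any convex function of it has no strict interior
maximum in `t`. The proof rescues this for interacting particles. If `y` is constant on the blocks
of a clustering, the forces inside blocks cancel in `⟨y, q''⟩`. If the blocks are at distance at
least `ℓ t`, the remaining forces are `O(t^(-1-ε'))`. Adding `-K t^(-ε')` with `K` large then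
prevents `⟨y, q(t)/t⟩` from having a local maximum (`exists_correction`).

The convex function used is `grafNorm`, the maximum over clusterings of `√(‖q^E_C‖² + 2μ²δ^|C|)`. It
stays within `2μ` of the mass norm. For small `δ` the blocks of a maximising clustering are
separated on the scale `μ` (`IsMaxClustering.lt_norm_sub`), so its supporting functionals are of the
kind above. Hence the corrected norm is quasi-convex along orbits, with `K` independent of the orbit
(`exists_quasiconvex_correctedNorm`).

Quasi-convexity excludes oscillation, so `j⁺` exists. If `j⁺` is finite, the same argument for `⟨v,
q/t⟩`, with `v` a limit point of `q/t`, shows that `q/t` cannot leave a neighbourhood of `v` again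
and again. Therefore `NAV` is the set where `j⁺ = ∞` (`mem_NAV_iff`).

Once the corrected norm exceeds an earlier value it cannot fall again, and by continuous dependence
this holds uniformly for nearby orbits. This yields continuity at `NAV`, wandering and
measurability. It also makes the derivative of the supporting functional nonnegative, which bounds
the external speed at a fixed scale from below. Refinement carries the bound over to cluster
functions, and energy conservation to the potential. -/

/-! ### The maximal flow: uniqueness, extension, continuous dependence. -/

lemma isOpen_noncollision : IsOpen (noncollision n d) := by
  simp only [noncollision, ofPred_forall]
  exact isOpen_iInter_of_finite fun i => isOpen_iInter_of_finite fun j =>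
    isOpen_iInter_of_finite fun _ => isOpen_ne_fun (continuous_apply i) (continuous_apply j)

lemma isOpen_phaseSpace : IsOpen (phaseSpace n d) :=
  isOpen_noncollision.preimage continuous_snd

lemma contDiffAt_gradient {f : EuclideanSpace ℝ (Fin d) → ℝ} {q : EuclideanSpace ℝ (Fin d)}
    (hf : ContDiffOn ℝ 2 f {0}ᶜ) (hq : q ≠ 0) : ContDiffAt ℝ 1 (gradient f) q := by
  have h : ContDiffAt ℝ 2 f q := hf.contDiffAt (isOpen_compl_singleton.mem_nhds hq)
  have h1 : ContDiffAt ℝ 1 (fderiv ℝ f) q := h.fderiv_right (by norm_num)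
  exact (InnerProductSpace.toDual ℝ (EuclideanSpace ℝ (Fin d))).symm.contDiff.contDiffAt.comp q h1

lemma contDiffAt_hamiltonianField
    (hV : ∀ i j : Fin n, i < j → ContDiffOn ℝ 2 (V i j) {0}ᶜ) {x : Phase n d}
    (hx : x ∈ phaseSpace n d) : ContDiffAt ℝ 1 (hamiltonianField m V) x := by
  have hq (i : Fin n) : ContDiffAt ℝ 1 (fun y : Phase n d => y.2 i) x :=
    ((contDiff_apply ℝ _ i).comp contDiff_snd).contDiffAt
  have hp (i : Fin n) : ContDiffAt ℝ 1 (fun y : Phase n d => y.1 i) x :=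
    ((contDiff_apply ℝ _ i).comp contDiff_fst).contDiffAt
  have hg (i j : Fin n) (hij : i < j) :
      ContDiffAt ℝ 1 (fun y : Phase n d => gradient (V i j) (y.2 i - y.2 j)) x :=
    ContDiffAt.comp (g := gradient (V i j)) x
      (contDiffAt_gradient (hV i j hij) (sub_ne_zero.2 (hx i j hij.ne))) ((hq i).sub (hq j))
  refine ContDiffAt.prodMk (contDiffAt_pi.2 fun i => ?_) (contDiffAt_pi.2 fun i => ?_)
  · refine ContDiffAt.sub (ContDiffAt.sum fun j hj => ?_) (ContDiffAt.sum fun j hj => ?_)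
    · exact hg j i (Finset.mem_Iio.1 hj)
    · exact hg i j (Finset.mem_Ioi.1 hj)
  · exact (hp i).const_smul _

/-- A local flow of the Hamiltonian vector field that stays in the phase space. -/
lemma exists_localFlow (hV : ∀ i j : Fin n, i < j → ContDiffOn ℝ 2 (V i j) {0}ᶜ) {z : Phase n d}
    (hz : z ∈ phaseSpace n d) :
    ∃ U : Set (Phase n d), IsOpen U ∧ z ∈ U ∧ ∃ η : ℝ, 0 < η ∧ ∃ α : Phase n d × ℝ → Phase n d,
      (∀ y ∈ U, α (y, 0) = y ∧ ∀ t ∈ Ioo (-η) η,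
        HasDerivAt (fun s => α (y, s)) (hamiltonianField m V (α (y, t))) t ∧
          α (y, t) ∈ phaseSpace n d) ∧
      ContinuousOn α (U ×ˢ Ioo (-η) η) := by
  obtain ⟨ε, hε, a, r, L, K, hr, hpl⟩ :=
    IsPicardLindelof.of_contDiffAt_one (contDiffAt_hamiltonianField (m := m) hV hz)
  obtain ⟨α, hα, hc⟩ := (hpl 0).exists_forall_mem_closedBall_eq_hasDerivWithinAt_continuousOn
  simp only [zero_sub, zero_add] at hα hc
  have hcz : ContinuousAt α (z, 0) :=
    hc.continuousAt (prod_mem_nhds (Metric.closedBall_mem_nhds z hr) (Icc_mem_nhds (by linarith) hε))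
  have hz0 : α (z, 0) = z := (hα z (Metric.mem_closedBall_self r.2)).1
  have hev : ∀ᶠ w in 𝓝 (z, (0 : ℝ)), α w ∈ phaseSpace n d :=
    hcz.eventually_mem (by rw [hz0]; exact isOpen_phaseSpace.mem_nhds hz)
  rw [nhds_prod_eq, (nhds_basis_opens z).prod (nhds_basis_zero_abs_lt ℝ) |>.eventually_iff] at hev
  obtain ⟨⟨U, η⟩, ⟨⟨hzU, hU⟩, hη⟩, hUη⟩ := hev
  have hsub : Ioo (-min η ε) (min η ε) ⊆ Ioo (-ε) ε :=
    Ioo_subset_Ioo (neg_le_neg (min_le_right _ _)) (min_le_right _ _)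
  refine ⟨U ∩ Metric.ball z r, hU.inter Metric.isOpen_ball, ⟨hzU, Metric.mem_ball_self hr⟩,
    min η ε, lt_min hη hε, α, fun y hy => ⟨(hα y (Metric.ball_subset_closedBall hy.2)).1,
      fun t ht => ⟨?_, ?_⟩⟩, hc.mono ?_⟩
  · exact ((hα y (Metric.ball_subset_closedBall hy.2)).2 t (Ioo_subset_Icc_self (hsub ht))).hasDerivAt
      (Icc_mem_nhds (hsub ht).1 (hsub ht).2)
  · refine hUη (x := (y, t)) ⟨hy.1, ?_⟩
    exact abs_lt.2 ⟨(neg_le_neg (min_le_left _ _)).trans_lt ht.1, ht.2.trans_le (min_le_left _ _)⟩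
  · exact prod_mono (inter_subset_right.trans Metric.ball_subset_closedBall)
      (hsub.trans Ioo_subset_Icc_self)

/-- The set of agreement is open by local uniqueness and closed by continuity, so it exhausts the
connected interval. -/
lemma eqOn_of_integralCurves (hV : ∀ i j : Fin n, i < j → ContDiffOn ℝ 2 (V i j) {0}ᶜ)
    {γ₁ γ₂ : ℝ → Phase n d} {a b t₀ : ℝ} (ht₀ : t₀ ∈ Ioo a b)
    (h₁ : ∀ t ∈ Ioo a b, HasDerivAt γ₁ (hamiltonianField m V (γ₁ t)) t ∧ γ₁ t ∈ phaseSpace n d)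
    (h₂ : ∀ t ∈ Ioo a b, HasDerivAt γ₂ (hamiltonianField m V (γ₂ t)) t ∧ γ₂ t ∈ phaseSpace n d)
    (h₀ : γ₁ t₀ = γ₂ t₀) : EqOn γ₁ γ₂ (Ioo a b) := by
  intro t ht
  refine isPreconnected_Ioo.induction₂' (fun u v => γ₁ u = γ₂ u → γ₁ v = γ₂ v) (fun u hu => ?_)
    (fun u v w _ _ _ huv hvw h => hvw (huv h)) ht₀ ht h₀
  apply Filter.Eventually.filter_mono nhdsWithin_le_nhds
  by_cases hu' : γ₁ u = γ₂ u
  · obtain ⟨K, s, hs, hl⟩ :=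
      (contDiffAt_hamiltonianField (m := m) hV (h₁ u hu).2).exists_lipschitzOnWith
    have hI := Ioo_mem_nhds hu.1 hu.2
    have key : γ₁ =ᶠ[𝓝 u] γ₂ := by
      refine ODE_solution_unique_of_eventually (v := fun _ => hamiltonianField m V) (s := fun _ => s)
        (Eventually.of_forall fun _ => hl) ?_ ?_ hu'
      · filter_upwards [hI, (h₁ u hu).1.continuousAt.eventually_mem hs] with t ht hts
        exact ⟨(h₁ t ht).1, hts⟩
      · filter_upwards [hI, (h₂ u hu).1.continuousAt.eventually_mem (hu' ▸ hs)] with t ht hts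
        exact ⟨(h₂ t ht).1, hts⟩
    filter_upwards [key] with v hv
    exact ⟨fun _ => hv, fun _ => hu'⟩
  · filter_upwards [((h₁ u hu).1.continuousAt.prodMk (h₂ u hu).1.continuousAt).eventually
      (isOpen_ne_fun continuous_fst continuous_snd |>.mem_nhds hu')] with v hv
    exact ⟨fun h => absurd h hu', fun h => absurd h hv⟩

lemma IsTrajectory.hasDerivAt_mem {x : Phase n d} {γ : ℝ → Phase n d} {a b : ℝ}
    (h : IsTrajectory m V x γ a b) : ∀ t ∈ Ioo a b,
      HasDerivAt γ (hamiltonianField m V (γ t)) t ∧ γ t ∈ phaseSpace n d := fun t ht =>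
  ⟨(h.isIntegralCurveOn t ht).hasDerivAt (Ioo_mem_nhds ht.1 ht.2), h.mem_phaseSpace t ht⟩

lemma isTrajectory_of_hasDerivAt {x : Phase n d} {γ : ℝ → Phase n d} {a b : ℝ}
    (h0 : (0 : ℝ) ∈ Ioo a b) (hx : γ 0 = x) (h : ∀ t ∈ Ioo a b,
      HasDerivAt γ (hamiltonianField m V (γ t)) t ∧ γ t ∈ phaseSpace n d) :
    IsTrajectory m V x γ a b :=
  ⟨h0, hx, fun t ht => (h t ht).2, fun t ht => (h t ht).1.hasDerivWithinAt⟩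

lemma IsTrajectory.flow_eq (hV : ∀ i j : Fin n, i < j → ContDiffOn ℝ 2 (V i j) {0}ᶜ)
    {x : Phase n d} {γ : ℝ → Phase n d} {a b : ℝ} (h : IsTrajectory m V x γ a b) {t : ℝ}
    (ht : t ∈ Ioo a b) : flow m V t x = γ t := by
  have hl : t ∈ lifetime m V x := ⟨γ, a, b, ht, h⟩
  rw [flow, dif_pos hl]
  obtain ⟨a', b', ht', h'⟩ := hl.choose_spec
  have h0 : (0 : ℝ) ∈ Ioo (max a a') (min b b') :=
    ⟨max_lt h.zero_mem.1 h'.zero_mem.1, lt_min h.zero_mem.2 h'.zero_mem.2⟩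
  refine eqOn_of_integralCurves hV h0
    (fun s hs => h'.hasDerivAt_mem s ⟨(le_max_right _ _).trans_lt hs.1,
      hs.2.trans_le (min_le_right _ _)⟩)
    (fun s hs => h.hasDerivAt_mem s ⟨(le_max_left _ _).trans_lt hs.1,
      hs.2.trans_le (min_le_left _ _)⟩) (h'.initial.trans h.initial.symm)
    ⟨max_lt ht.1 ht'.1, lt_min ht.2 ht'.2⟩

lemma lifetime_mem_nhds {x : Phase n d} {t : ℝ} (ht : t ∈ lifetime m V x) :
    lifetime m V x ∈ 𝓝 t := by
  obtain ⟨γ, a, b, htab, h⟩ := ht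
  exact mem_of_superset (Ioo_mem_nhds htab.1 htab.2) fun s hs => ⟨γ, a, b, hs, h⟩

lemma hasDerivAt_flow (hV : ∀ i j : Fin n, i < j → ContDiffOn ℝ 2 (V i j) {0}ᶜ)
    {x : Phase n d} {t : ℝ} (ht : t ∈ lifetime m V x) :
    HasDerivAt (fun s => flow m V s x) (hamiltonianField m V (flow m V t x)) t := by
  obtain ⟨γ, a, b, htab, h⟩ := ht
  rw [h.flow_eq hV htab]
  refine (h.hasDerivAt_mem t htab).1.congr_of_eventuallyEq ?_
  filter_upwards [Ioo_mem_nhds htab.1 htab.2] with s hs using h.flow_eq hV hs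

lemma flow_mem_phaseSpace (hV : ∀ i j : Fin n, i < j → ContDiffOn ℝ 2 (V i j) {0}ᶜ)
    {x : Phase n d} {t : ℝ} (ht : t ∈ lifetime m V x) : flow m V t x ∈ phaseSpace n d := by
  obtain ⟨γ, a, b, htab, h⟩ := ht
  rw [h.flow_eq hV htab]
  exact h.mem_phaseSpace t htab

lemma zero_mem_lifetime (hV : ∀ i j : Fin n, i < j → ContDiffOn ℝ 2 (V i j) {0}ᶜ)
    {x : Phase n d} (hx : x ∈ phaseSpace n d) : (0 : ℝ) ∈ lifetime m V x := by
  obtain ⟨U, -, hxU, η, hη, α, hα, -⟩ := exists_localFlow (m := m) hV hx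
  have h0 : (0 : ℝ) ∈ Ioo (-η) η := ⟨neg_lt_zero.2 hη, hη⟩
  exact ⟨fun s => α (x, s), -η, η, h0, isTrajectory_of_hasDerivAt h0 (hα x hxU).1 (hα x hxU).2⟩

lemma flow_zero (hV : ∀ i j : Fin n, i < j → ContDiffOn ℝ 2 (V i j) {0}ᶜ)
    {x : Phase n d} (hx : x ∈ phaseSpace n d) : flow m V 0 x = x := by
  obtain ⟨γ, a, b, h0, h⟩ := zero_mem_lifetime (m := m) hV hx
  rw [h.flow_eq hV h0, h.initial]

lemma mem_lifetime_of_mem_uIcc {x : Phase n d} {s t : ℝ} (ht : t ∈ lifetime m V x)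
    (hs : s ∈ uIcc 0 t) : s ∈ lifetime m V x := by
  obtain ⟨γ, a, b, htab, h⟩ := ht
  exact ⟨γ, a, b, ordConnected_Ioo.uIcc_subset h.zero_mem htab hs, h⟩

lemma mem_lifetime_of_nonneg {x : Phase n d} {t : ℝ} (h0 : 0 ≤ t)
    (ht : (t : EReal) < escapeTime m V x) : t ∈ lifetime m V x := by
  obtain ⟨_, ⟨s, hs, rfl⟩, hts⟩ := lt_sSup_iff.1 ht
  exact mem_lifetime_of_mem_uIcc hs (mem_uIcc_of_le h0 (EReal.coe_lt_coe_iff.1 hts).le)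

lemma mem_lifetime_of_mem_flowDomain {z : ℝ × Phase n d}
    (hz : z ∈ flowDomain m V) : z.1 ∈ lifetime m V z.2 := by
  rcases le_total 0 z.1 with h | h
  · exact mem_lifetime_of_nonneg h hz.2.2
  · obtain ⟨_, ⟨s, hs, rfl⟩, hts⟩ := sInf_lt_iff.1 hz.2.1
    exact mem_lifetime_of_mem_uIcc hs (mem_uIcc_of_ge (EReal.coe_lt_coe_iff.1 hts).le h)

lemma lt_escapeTime_of_mem_lifetime {x : Phase n d} {t : ℝ} (ht : t ∈ lifetime m V x) :
    (t : EReal) < escapeTime m V x := by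
  obtain ⟨s, hts, hs⟩ := (lifetime_mem_nhds ht |> mem_nhds_iff_exists_Ioo_subset.1)
  obtain ⟨u, htu, hus⟩ := exists_between hs.1.2
  exact lt_of_lt_of_le (EReal.coe_lt_coe_iff.2 htu)
    (le_sSup ⟨u, hs.2 ⟨hs.1.1.trans htu, hus⟩, rfl⟩)

/-- Gluing a trajectory to a local solution started at time `s`. This both prolongs the lifetime and
supplies the group property needed for continuous dependence. -/
lemma flow_extend (hV : ∀ i j : Fin n, i < j → ContDiffOn ℝ 2 (V i j) {0}ᶜ)
    {y : Phase n d} {s η : ℝ} (hη : 0 < η) (hs : s ∈ lifetime m V y) {β : ℝ → Phase n d}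
    (hβ0 : β 0 = flow m V s y) (hβ : ∀ t ∈ Ioo (-η) η,
      HasDerivAt β (hamiltonianField m V (β t)) t ∧ β t ∈ phaseSpace n d) {u : ℝ}
    (hu : u - s ∈ Ioo (-η) η) : u ∈ lifetime m V y ∧ flow m V u y = β (u - s) := by
  obtain ⟨γ, a, b, hsab, h⟩ := hs
  rw [h.flow_eq hV hsab] at hβ0
  have hβ' : ∀ t ∈ Ioo (s - η) (s + η),
      HasDerivAt (fun t => β (t - s)) (hamiltonianField m V (β (t - s))) t ∧
        β (t - s) ∈ phaseSpace n d := fun t ht => by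
    have := hβ (t - s) ⟨by linarith [ht.1], by linarith [ht.2]⟩
    exact ⟨this.1.comp_sub_const t s, this.2⟩
  have hagree : ∀ t ∈ Ioo a b, t ∈ Ioo (s - η) (s + η) → γ t = β (t - s) := fun t ht ht' => by
    refine eqOn_of_integralCurves hV (a := max a (s - η)) (b := min b (s + η)) (t₀ := s)
      ⟨max_lt hsab.1 (by linarith), lt_min hsab.2 (by linarith)⟩
      (fun v hv => h.hasDerivAt_mem v ⟨(le_max_left _ _).trans_lt hv.1,
        hv.2.trans_le (min_le_left _ _)⟩)
      (fun v hv => hβ' v ⟨(le_max_right _ _).trans_lt hv.1, hv.2.trans_le (min_le_right _ _)⟩)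
      (by simp [hβ0]) ⟨max_lt ht.1 ht'.1, lt_min ht.2 ht'.2⟩
  classical
  set δ : ℝ → Phase n d := fun t => if t ∈ Ioo a b then γ t else β (t - s) with hδ
  have hδ1 : ∀ t ∈ Ioo a b, δ t = γ t := fun t ht => if_pos ht
  have hδ2 : ∀ t ∈ Ioo (s - η) (s + η), δ t = β (t - s) := fun t ht => by
    by_cases htab : t ∈ Ioo a b
    · rw [hδ1 t htab, hagree t htab ht]
    · exact if_neg htab
  have hu' : u ∈ Ioo (s - η) (s + η) := ⟨by linarith [hu.1], by linarith [hu.2]⟩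
  have hδt : IsTrajectory m V y δ (min a (s - η)) (max b (s + η)) := by
    refine isTrajectory_of_hasDerivAt ⟨(min_le_left _ _).trans_lt h.zero_mem.1,
      h.zero_mem.2.trans_le (le_max_left _ _)⟩ ((hδ1 0 h.zero_mem).trans h.initial) fun t ht => ?_
    by_cases htab : t ∈ Ioo a b
    · rw [hδ1 t htab]
      refine ⟨(h.hasDerivAt_mem t htab).1.congr_of_eventuallyEq ?_, (h.hasDerivAt_mem t htab).2⟩
      filter_upwards [Ioo_mem_nhds htab.1 htab.2] with v hv using hδ1 v hv
    · have ht' : t ∈ Ioo (s - η) (s + η) := by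
        simp only [mem_Ioo, not_and_or, not_lt] at htab ht hsab ⊢
        rcases htab with h1 | h1
        · exact ⟨by rcases min_lt_iff.1 ht.1 with h2 | h2 <;> linarith, by linarith⟩
        · exact ⟨by linarith, by rcases lt_max_iff.1 ht.2 with h2 | h2 <;> linarith⟩
      rw [hδ2 t ht']
      refine ⟨(hβ' t ht').1.congr_of_eventuallyEq ?_, (hβ' t ht').2⟩
      filter_upwards [Ioo_mem_nhds ht'.1 ht'.2] with v hv using hδ2 v hv
  have hmem : u ∈ Ioo (min a (s - η)) (max b (s + η)) :=
    ⟨(min_le_right _ _).trans_lt hu'.1, hu'.2.trans_le (le_max_right _ _)⟩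
  exact ⟨⟨δ, _, _, hmem, hδt⟩, by rw [hδt.flow_eq hV hmem, hδ2 u hu']⟩

/-- Continuous dependence of the flow on the initial condition. -/
lemma continuousAt_flow (hV : ∀ i j : Fin n, i < j → ContDiffOn ℝ 2 (V i j) {0}ᶜ)
    {x : Phase n d} (hx : x ∈ phaseSpace n d) {t : ℝ} (ht : t ∈ lifetime m V x) :
    (∀ᶠ y in 𝓝 x, t ∈ lifetime m V y) ∧ ContinuousAt (flow m V t) x := by
  have hsub : uIcc 0 t ⊆ lifetime m V x := fun s hs => mem_lifetime_of_mem_uIcc ht hs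
  have hP : ∀ᶠ y in 𝓝 x, y ∈ phaseSpace n d := isOpen_phaseSpace.mem_nhds hx
  refine isPreconnected_uIcc.induction₂' (s := uIcc 0 t)
    (fun u v => ((∀ᶠ y in 𝓝 x, u ∈ lifetime m V y) ∧ ContinuousAt (flow m V u) x) →
      ((∀ᶠ y in 𝓝 x, v ∈ lifetime m V y) ∧ ContinuousAt (flow m V v) x)) (fun u hu => ?_)
    (fun u v w _ _ _ huv hvw h => hvw (huv h)) left_mem_uIcc right_mem_uIcc ⟨?_, ?_⟩
  · obtain ⟨U, hU, hxU, η, hη, α, hα, hc⟩ :=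
      exists_localFlow (m := m) hV (flow_mem_phaseSpace hV (hsub hu))
    -- The local flow lives for the same time `η` from every point of `U`, so regularity at time `v`
    -- passes to `w` whether `w` is later or earlier. The induction along `[0, t]` needs both
    -- directions.
    have step : ∀ v w : ℝ, v ∈ lifetime m V x → w - v ∈ Ioo (-η) η → flow m V v x ∈ U →
        ((∀ᶠ y in 𝓝 x, v ∈ lifetime m V y) ∧ ContinuousAt (flow m V v) x) →
        ((∀ᶠ y in 𝓝 x, w ∈ lifetime m V y) ∧ ContinuousAt (flow m V w) x) := by
      intro v w hv hwv hvU ⟨h1, h2⟩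
      have key : ∀ᶠ y in 𝓝 x, w ∈ lifetime m V y ∧
          flow m V w y = α (flow m V v y, w - v) := by
        filter_upwards [h1, h2.eventually_mem (hU.mem_nhds hvU)] with y hy hyU
        exact flow_extend hV hη hy (β := fun s => α (flow m V v y, s)) (hα _ hyU).1 (hα _ hyU).2 hwv
      refine ⟨key.mono fun y hy => hy.1, ContinuousAt.congr ?_
        (key.mono fun y hy => hy.2.symm)⟩
      have h3 : ContinuousAt α (flow m V v x, w - v) :=
        hc.continuousAt (prod_mem_nhds (hU.mem_nhds hvU) (Ioo_mem_nhds hwv.1 hwv.2))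
      exact ContinuousAt.comp (f := fun y => (flow m V v y, w - v)) h3
        (h2.prodMk continuousAt_const)
    have hcu : ∀ᶠ v in 𝓝 u, flow m V v x ∈ U :=
      (hasDerivAt_flow hV (hsub hu)).continuousAt.eventually_mem (hU.mem_nhds hxU)
    apply Filter.Eventually.filter_mono nhdsWithin_le_nhds
    filter_upwards [hcu, lifetime_mem_nhds (hsub hu),
      Ioo_mem_nhds (show u - η < u by linarith) (show u < u + η by linarith)] with v hvU hvl hvη
    exact ⟨step u v (hsub hu) ⟨by linarith [hvη.1], by linarith [hvη.2]⟩ hxU,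
      step v u hvl ⟨by linarith [hvη.2], by linarith [hvη.1]⟩ hvU⟩
  · exact hP.mono fun y hy => zero_mem_lifetime hV hy
  · exact continuousAt_id.congr (hP.mono fun y hy => (flow_zero hV hy).symm)

/-! ### The filter at the escape time. -/

lemma escapeTime_pos (hV : ∀ i j : Fin n, i < j → ContDiffOn ℝ 2 (V i j) {0}ᶜ)
    {x : Phase n d} (hx : x ∈ phaseSpace n d) : (0 : EReal) < escapeTime m V x := by
  simpa using lt_escapeTime_of_mem_lifetime (zero_mem_lifetime (m := m) hV hx)

lemma toEscape_hasBasis (hV : ∀ i j : Fin n, i < j → ContDiffOn ℝ 2 (V i j) {0}ᶜ)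
    {x : Phase n d} (hx : x ∈ phaseSpace n d) :
    (toEscape m V x).HasBasis (fun a : ℝ => (a : EReal) < escapeTime m V x)
      (fun a => {t : ℝ | a < t ∧ (t : EReal) < escapeTime m V x}) := by
  have h0 := escapeTime_pos (m := m) hV hx
  refine ((nhdsLT_basis_of_exists_lt ⟨0, h0⟩).comap _).to_hasBasis (fun a ha => ?_) fun a ha => ?_
  · obtain ⟨b, hb, hb'⟩ := EReal.lt_iff_exists_real_btwn.1 ha
    exact ⟨b, hb', fun t ht => ⟨hb.trans (EReal.coe_lt_coe_iff.2 ht.1), ht.2⟩⟩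
  · exact ⟨a, ha, fun t ht => ⟨EReal.coe_lt_coe_iff.1 ht.1, ht.2⟩⟩

lemma toEscape_neBot (hV : ∀ i j : Fin n, i < j → ContDiffOn ℝ 2 (V i j) {0}ᶜ)
    {x : Phase n d} (hx : x ∈ phaseSpace n d) : (toEscape m V x).NeBot := by
  refine (toEscape_hasBasis hV hx).neBot_iff.2 fun {a} ha => ?_
  obtain ⟨b, hb, hb'⟩ := EReal.lt_iff_exists_real_btwn.1 ha
  exact ⟨b, EReal.coe_lt_coe_iff.1 hb, hb'⟩

/-! ### The mass inner product and the cluster projections. -/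

/-- The bilinear form `⟨q, q'⟩_𝓜` given by the mass matrix. -/
noncomputable def massInner (m : Fin n → ℝ) (q q' : Config n d) : ℝ := ∑ i, m i * inner ℝ (q i) (q' i)

lemma massInner_comm (q q' : Config n d) : massInner m q q' = massInner m q' q := by
  simp only [massInner, real_inner_comm]

lemma massInner_sub_left (q q' y : Config n d) :
    massInner m (q - q') y = massInner m q y - massInner m q' y := by
  simp only [massInner, Pi.sub_apply, inner_sub_left, mul_sub, Finset.sum_sub_distrib]

lemma massInner_sub_right (y q q' : Config n d) :
    massInner m y (q - q') = massInner m y q - massInner m y q' := by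
  rw [massInner_comm, massInner_sub_left, massInner_comm q, massInner_comm q']

lemma massInner_smul_left (c : ℝ) (q y : Config n d) :
    massInner m (c • q) y = c * massInner m q y := by
  simp only [massInner, Pi.smul_apply, real_inner_smul_left, Finset.mul_sum]
  exact Finset.sum_congr rfl fun i _ => by ring

lemma massInner_smul_right (c : ℝ) (y q : Config n d) :
    massInner m y (c • q) = c * massInner m y q := by
  rw [massInner_comm, massInner_smul_left, massInner_comm]

lemma massInner_self (q : Config n d) : massInner m q q = ∑ i, m i * ‖q i‖ ^ 2 := by
  simp only [massInner, real_inner_self_eq_norm_sq]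

lemma massInner_self_nonneg (hm : ∀ i, 0 < m i) (q : Config n d) : 0 ≤ massInner m q q := by
  rw [massInner_self]
  exact Finset.sum_nonneg fun i _ => mul_nonneg (hm i).le (sq_nonneg _)

lemma inertia_eq (q : Config n d) : inertia m q = (1 / 2) * massInner m q q := by
  rw [inertia, massInner_self]

lemma massNorm_eq (q : Config n d) : massNorm m q = Real.sqrt (massInner m q q) := by
  rw [massNorm, massInner_self]

lemma mul_norm_sq_le_massInner (hm : ∀ i, 0 < m i) (q : Config n d) (i : Fin n) :
    m i * ‖q i‖ ^ 2 ≤ massInner m q q := by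
  rw [massInner_self]
  exact Finset.single_le_sum (f := fun i => m i * ‖q i‖ ^ 2)
    (fun i _ => mul_nonneg (hm i).le (sq_nonneg _)) (Finset.mem_univ i)

lemma continuous_massInner : Continuous fun z : Config n d × Config n d => massInner m z.1 z.2 := by
  unfold massInner
  fun_prop

lemma exists_mass_lower_bound (hm : ∀ i, 0 < m i) : ∃ m₀ : ℝ, 0 < m₀ ∧ ∀ i, m₀ ≤ m i := by
  rcases isEmpty_or_nonempty (Fin n) with h | h
  · exact ⟨1, one_pos, fun i => h.elim i⟩
  · obtain ⟨i, hi⟩ := Finite.exists_min m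
    exact ⟨m i, hm i, hi⟩

/-- Configurations in which particles of the same cluster have the same position. -/
def BlockConst (C : Clustering n) (y : Config n d) : Prop :=
  ∀ i j, C.part i = C.part j → y i = y j

lemma mem_part_iff (C : Clustering n) (i j : Fin n) : j ∈ C.part i ↔ C.part j = C.part i :=
  C.mem_part_iff_part_eq_part (Finset.mem_univ _) (Finset.mem_univ _)

lemma blockConst_extProj (C : Clustering n) (q : Config n d) : BlockConst C (extProj m C q) :=
  fun i j h => by simp only [extProj, h]

/-- After exchanging the sums, each particle collects the total mass of its block, which cancels the
normalisation of the barycenter. This is the orthogonality of the projection. -/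
lemma massInner_extProj_left (hm : ∀ i, 0 < m i) {C : Clustering n} {y : Config n d}
    (hy : BlockConst C y) (q : Config n d) :
    massInner m (extProj m C q) y = massInner m q y := by
  have hW (i : Fin n) : 0 < ∑ j ∈ C.part i, m j :=
    Finset.sum_pos (fun j _ => hm j) ⟨i, (mem_part_iff C i i).2 rfl⟩
  have h1 : massInner m (extProj m C q) y = ∑ i, ∑ j, if C.part j = C.part i then
      m i * (m j * (∑ l ∈ C.part j, m l)⁻¹ * inner ℝ (q j) (y j)) else 0 := by
    refine Finset.sum_congr rfl fun i _ => ?_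
    rw [← Finset.sum_filter]
    have : (Finset.univ.filter fun j => C.part j = C.part i) = C.part i := by
      ext j; simp [mem_part_iff]
    rw [this, extProj, barycenter, real_inner_smul_left, sum_inner, Finset.mul_sum, Finset.mul_sum]
    refine Finset.sum_congr rfl fun j hj => ?_
    rw [mem_part_iff] at hj
    rw [real_inner_smul_left, hj, hy j i hj]
    ring
  rw [h1, Finset.sum_comm]
  refine Finset.sum_congr rfl fun j _ => ?_
  rw [← Finset.sum_filter, ← Finset.sum_mul]
  have : (Finset.univ.filter fun i => C.part j = C.part i) = C.part j := by
    ext i; simp [mem_part_iff, eq_comm]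
  rw [this]
  field_simp [(hW j).ne']

/-- Pythagoras: `q - q^E` is orthogonal to block-constant configurations. -/
lemma massInner_sub_extProj_of_blockConst (hm : ∀ i, 0 < m i) {C : Clustering n} {y : Config n d}
    (hy : BlockConst C y) (q : Config n d) :
    massInner m (q - y) (q - y) =
      (massInner m q q - massInner m (extProj m C q) (extProj m C q)) +
        massInner m (extProj m C q - y) (extProj m C q - y) := by
  have h1 := massInner_extProj_left hm hy q
  have h2 := massInner_extProj_left hm (blockConst_extProj (m := m) C q) q
  simp only [massInner_sub_left, massInner_sub_right]
  rw [massInner_comm y q, massInner_comm y (extProj m C q), h1]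
  ring

/-- A configuration constant on coarse blocks is constant on fine ones, so the coarse projection
factors through the fine one. -/
lemma massInner_extProj_le_of_refines (hm : ∀ i, 0 < m i) {A B : Clustering n}
    (h : ∀ i j, A.part i = A.part j → B.part i = B.part j) (q : Config n d) :
    massInner m (extProj m B q) (extProj m B q) ≤ massInner m (extProj m A q) (extProj m A q) := by
  have hB : BlockConst A (extProj m B q) := fun i j hij => blockConst_extProj B q i j (h i j hij)
  have h1 := massInner_extProj_left hm hB q
  have h2 := massInner_extProj_left hm (blockConst_extProj (m := m) B q) q
  have h3 := massInner_self_nonneg hm (extProj m A q - extProj m B q)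
  simp only [massInner_sub_left, massInner_sub_right] at h3
  rw [massInner_comm (extProj m B q) (extProj m A q), h1, ← h2] at h3
  linarith

lemma massInner_extProj_le (hm : ∀ i, 0 < m i) (C : Clustering n) (q : Config n d) :
    massInner m (extProj m C q) (extProj m C q) ≤ massInner m q q := by
  have h := massInner_sub_extProj_of_blockConst hm (blockConst_extProj (m := m) C q) q
  have h1 := massInner_self_nonneg hm (q - extProj m C q)
  simp only [sub_self] at h
  simp only [massInner, Pi.zero_apply, inner_zero_left, mul_zero, Finset.sum_const_zero,
    add_zero] at h h1 ⊢
  linarith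

lemma part_bot_injective {i j : Fin n} (h : (⊥ : Clustering n).part i = (⊥ : Clustering n).part j) :
    i = j := by
  have h1 := (mem_part_iff ⊥ j i).2 h
  obtain ⟨p, hp, hi, hj⟩ := (Finpartition.mem_part_iff_exists _).1 h1
  obtain ⟨a, -, rfl⟩ := Finpartition.mem_bot_iff.1 hp
  rw [Finset.mem_singleton] at hi hj
  rw [hi, hj]

lemma massInner_extProj_bot (hm : ∀ i, 0 < m i) (q : Config n d) :
    massInner m (extProj m ⊥ q) (extProj m ⊥ q) = massInner m q q := by
  have hq : BlockConst ⊥ q := fun i j h => by rw [part_bot_injective h]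
  rw [massInner_extProj_left hm (blockConst_extProj _ q), massInner_comm,
    massInner_extProj_left hm hq]

lemma extProj_smul (C : Clustering n) (c : ℝ) (q : Config n d) :
    extProj m C (c • q) = c • extProj m C q := by
  ext1 i
  simp only [extProj, barycenter, Pi.smul_apply, smul_comm _ c, Finset.smul_sum]

lemma hasDerivAt_extProj {C : Clustering n} {q : ℝ → Config n d} {v : Config n d} {t : ℝ}
    (h : HasDerivAt q v t) : HasDerivAt (fun s => extProj m C (q s)) (extProj m C v) t := by
  refine hasDerivAt_pi.2 fun i => ?_
  have hj (j : Fin n) : HasDerivAt (fun s => m j • q s j) (m j • v j) t :=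
    (hasDerivAt_pi.1 h j).fun_const_smul (m j)
  exact (HasDerivAt.fun_sum fun j (_ : j ∈ C.part i) => hj j).fun_const_smul _

lemma continuous_extProj (C : Clustering n) :
    Continuous fun q : Config n d => extProj m C q := by
  unfold extProj barycenter
  fun_prop

/-- Merging the clusters of two particles. -/
lemma exists_merge (C : Clustering n) {i j : Fin n} (hij : C.part i ≠ C.part j) :
    ∃ C' : Clustering n, C'.parts.card + 1 ≤ C.parts.card ∧ ∀ k l, C'.part k = C'.part l →
      C.part k = C.part l ∨ ((C.part k = C.part i ∨ C.part k = C.part j) ∧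
        (C.part l = C.part i ∨ C.part l = C.part j)) := by
  classical
  set f : Fin n → Finset (Fin n) := fun l => if C.part l = C.part j then C.part i else C.part l
    with hf
  set C' : Clustering n := Finpartition.ofSetoid (Setoid.ker f) with hC'
  have hC (k l : Fin n) : C'.part k = C'.part l ↔ f k = f l := by
    rw [← mem_part_iff, hC', Finpartition.mem_part_ofSetoid_iff_rel]
    exact eq_comm
  refine ⟨C', ?_, fun k l hkl => ?_⟩
  · have hmem : C.part j ∈ C.parts := C.part_mem.2 (Finset.mem_univ _)
    rw [← Finset.card_erase_add_one hmem, add_le_add_iff_right]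
    have hne (p : Finset (Fin n)) (hp : p ∈ C'.parts) : p.Nonempty := C'.nonempty_of_mem_parts hp
    refine Finset.card_le_card_of_injOn
      (fun p => if h : p.Nonempty then f h.choose else ∅) (fun p hp => ?_) fun p hp p' hp' h => ?_
    · simp only [dif_pos (hne p hp), Finset.coe_erase, hf]
      split_ifs with h
      · exact ⟨C.part_mem.2 (Finset.mem_univ _), hij⟩
      · exact ⟨C.part_mem.2 (Finset.mem_univ _), h⟩
    · simp only [dif_pos (hne p hp), dif_pos (hne p' hp')] at h
      rw [← C'.part_eq_of_mem hp (hne p hp).choose_spec,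
        ← C'.part_eq_of_mem hp' (hne p' hp').choose_spec]
      exact (hC _ _).2 h
  · rw [hC] at hkl
    simp only [hf] at hkl
    split_ifs at hkl <;> tauto

/-! ### Geometry of the Graf partition. -/

/-- Twice the quantity maximised by the members of the Graf partition, at length scale `μ`. -/
noncomputable def clusterWeight (m : Fin n → ℝ) (δ μ : ℝ) (C : Clustering n) (q : Config n d) : ℝ :=
  massInner m (extProj m C q) (extProj m C q) + 2 * μ ^ 2 * δ ^ C.parts.card

/-- `C` maximises the cluster weight of `q`. -/
def IsMaxClustering (m : Fin n → ℝ) (δ μ : ℝ) (q : Config n d) (C : Clustering n) : Prop :=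
  ∀ C' : Clustering n, clusterWeight m δ μ C' q ≤ clusterWeight m δ μ C q

lemma exists_isMaxClustering (m : Fin n → ℝ) (δ μ : ℝ) (q : Config n d) :
    ∃ C, IsMaxClustering m δ μ q C :=
  Finite.exists_max fun C : Clustering n => clusterWeight m δ μ C q

section Geometry

variable {δ μ : ℝ} {q : Config n d} {C : Clustering n}

/-- Compare with the partition into singletons, for which nothing is internal. -/
lemma IsMaxClustering.internal_le (hm : ∀ i, 0 < m i) (hδ : 0 < δ)
    (h : IsMaxClustering m δ μ q C) :
    massInner m q q - massInner m (extProj m C q) (extProj m C q) ≤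
      2 * μ ^ 2 * δ ^ C.parts.card := by
  have h1 := h ⊥
  rw [clusterWeight, clusterWeight, massInner_extProj_bot hm] at h1
  have : 0 ≤ 2 * μ ^ 2 * δ ^ (⊥ : Clustering n).parts.card := by positivity
  linarith

lemma IsMaxClustering.norm_sub_extProj_le (hm : ∀ i, 0 < m i) (hδ : 0 < δ)
    (h : IsMaxClustering m δ μ q C) {m₀ : ℝ} (hm₀ : ∀ i, m₀ ≤ m i) (i : Fin n) :
    m₀ * ‖q i - extProj m C q i‖ ^ 2 ≤ 2 * μ ^ 2 * δ ^ C.parts.card := by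
  have h1 := massInner_sub_extProj_of_blockConst hm (blockConst_extProj (m := m) C q) q
  have h2 := mul_norm_sq_le_massInner hm (q - extProj m C q) i
  have h3 : massInner m (extProj m C q - extProj m C q) (extProj m C q - extProj m C q) = 0 := by
    simp [massInner]
  have h4 : m₀ * ‖q i - extProj m C q i‖ ^ 2 ≤ m i * ‖(q - extProj m C q) i‖ ^ 2 :=
    mul_le_mul_of_nonneg_right (hm₀ i) (sq_nonneg _)
  linarith [h.internal_le hm hδ]

lemma IsMaxClustering.norm_sub_le (hm : ∀ i, 0 < m i) (hδ : 0 < δ)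
    (h : IsMaxClustering m δ μ q C) {m₀ : ℝ} (hm₀' : 0 < m₀) (hm₀ : ∀ i, m₀ ≤ m i) {i j : Fin n}
    (hij : C.part i = C.part j) :
    m₀ * ‖q i - q j‖ ^ 2 ≤ 8 * μ ^ 2 * δ ^ C.parts.card := by
  have hi := h.norm_sub_extProj_le hm hδ hm₀ i
  have hj := h.norm_sub_extProj_le hm hδ hm₀ j
  rw [blockConst_extProj C q i j hij] at hi
  have h1 : ‖q i - q j‖ ≤ ‖q i - extProj m C q j‖ + ‖q j - extProj m C q j‖ := by
    rw [← norm_sub_rev (extProj m C q j) (q j)]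
    exact norm_sub_le_norm_sub_add_norm_sub _ _ _
  have h2 : ‖q i - q j‖ ^ 2 ≤ 2 * (‖q i - extProj m C q j‖ ^ 2 + ‖q j - extProj m C q j‖ ^ 2) := by
    nlinarith [norm_nonneg (q i - q j), sq_nonneg (‖q i - extProj m C q j‖ - ‖q j - extProj m C q j‖)]
  nlinarith [mul_le_mul_of_nonneg_left h2 hm₀'.le]

/-- If two blocks were closer, merging them would win: it loses external inertia comparable to
`μ²δ^|C|`, but raises the weight term by at least a factor `1/δ`. -/
lemma IsMaxClustering.lt_norm_sub (hm : ∀ i, 0 < m i) (hδ : 0 < δ) (hμ : 0 < μ)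
    (h : IsMaxClustering m δ μ q C) {m₀ : ℝ} (hm₀' : 0 < m₀) (hm₀ : ∀ i, m₀ ≤ m i)
    (hδ₀ : δ * (m₀ + 16 * ∑ i, m i) < m₀) {i j : Fin n} (hij : C.part i ≠ C.part j) :
    8 * μ ^ 2 * δ ^ C.parts.card < m₀ * ‖q i - q j‖ ^ 2 := by
  classical
  by_contra! hlt
  obtain ⟨C', hcard, hC'⟩ := exists_merge C hij
  set E := 2 * μ ^ 2 * δ ^ C.parts.card with hE
  have hE0 : 0 < E := by positivity
  -- A competitor that spares computing the new barycenter: by Pythagoras, the projection for `C'`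
  -- is at least as close to `q` as any `C'`-constant configuration.
  set y : Config n d := fun l => if C.part l = C.part i ∨ C.part l = C.part j then q i
    else extProj m C q l with hy
  have hyC : BlockConst C' y := by
    intro k l hkl
    have := hC' k l hkl
    simp only [hy]
    by_cases hk : C.part k = C.part i ∨ C.part k = C.part j
    · have hl : C.part l = C.part i ∨ C.part l = C.part j := by
        rcases this with h1 | h1
        · rwa [← h1]
        · exact h1.2
      rw [if_pos hk, if_pos hl]
    · have hkl' : C.part k = C.part l := by tauto
      rw [if_neg hk, if_neg (by rwa [← hkl']), blockConst_extProj C q k l hkl']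
  have hclose (l : Fin n) (hl : C.part l = C.part i ∨ C.part l = C.part j) :
      m₀ * ‖q l - q i‖ ^ 2 ≤ 16 * E := by
    rcases hl with hl | hl
    · have := h.norm_sub_le hm hδ hm₀' hm₀ hl
      linarith
    · have h1 := h.norm_sub_le hm hδ hm₀' hm₀ hl
      have h2 : ‖q l - q i‖ ≤ ‖q l - q j‖ + ‖q i - q j‖ := by
        rw [norm_sub_rev (q i)]
        exact norm_sub_le_norm_sub_add_norm_sub _ _ _
      have h3 : ‖q l - q i‖ ^ 2 ≤ 2 * (‖q l - q j‖ ^ 2 + ‖q i - q j‖ ^ 2) := by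
        nlinarith [norm_nonneg (q l - q i), sq_nonneg (‖q l - q j‖ - ‖q i - q j‖)]
      nlinarith [mul_le_mul_of_nonneg_left h3 hm₀'.le]
  have hterm (l : Fin n) : m l * ‖(q - y) l‖ ^ 2 ≤
      m l * ‖(q - extProj m C q) l‖ ^ 2 + m l * (16 * E / m₀) := by
    simp only [Pi.sub_apply, hy]
    split_ifs with hl
    · have h1 : ‖q l - q i‖ ^ 2 ≤ 16 * E / m₀ := by
        rw [le_div_iff₀ hm₀', mul_comm]; exact hclose l hl
      have h2 : 0 ≤ m l * ‖q l - extProj m C q l‖ ^ 2 := mul_nonneg (hm l).le (sq_nonneg _)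
      linarith [mul_le_mul_of_nonneg_left h1 (hm l).le]
    · have : 0 ≤ m l * (16 * E / m₀) := mul_nonneg (hm l).le (by positivity)
      linarith
  have hsum : massInner m (q - y) (q - y) ≤
      massInner m (q - extProj m C q) (q - extProj m C q) + (∑ l, m l) * (16 * E / m₀) := by
    rw [massInner_self, massInner_self, Finset.sum_mul, ← Finset.sum_add_distrib]
    exact Finset.sum_le_sum fun l _ => hterm l
  have h1 := massInner_sub_extProj_of_blockConst hm hyC q
  have h2 := massInner_self_nonneg hm (extProj m C' q - y)
  have h3 := massInner_sub_extProj_of_blockConst hm (blockConst_extProj (m := m) C q) q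
  have h4 : massInner m (extProj m C q - extProj m C q) (extProj m C q - extProj m C q) = 0 := by
    simp [massInner]
  have h5 := h C'
  rw [clusterWeight, clusterWeight, ← hE] at h5
  have hM : 0 ≤ ∑ l, m l := Finset.sum_nonneg fun l _ => (hm l).le
  have hδ1 : δ ≤ 1 := by nlinarith
  have h6 : 2 * μ ^ 2 * δ ^ (C.parts.card - 1) ≤ 2 * μ ^ 2 * δ ^ C'.parts.card :=
    mul_le_mul_of_nonneg_left (pow_le_pow_of_le_one hδ.le hδ1 (by omega)) (by positivity)
  have h7 : E = δ * (2 * μ ^ 2 * δ ^ (C.parts.card - 1)) := by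
    have hk : C.parts.card = (C.parts.card - 1) + 1 := by omega
    rw [hE]
    nth_rw 1 [hk]
    rw [pow_succ]; ring
  set G := 2 * μ ^ 2 * δ ^ (C.parts.card - 1) with hG
  have hG0 : 0 < G := by positivity
  have h8 : G ≤ E + (∑ l, m l) * (16 * E / m₀) := by linarith
  rw [h7] at h8
  have h9 : m₀ * G ≤ m₀ * (δ * G + (∑ l, m l) * (16 * (δ * G) / m₀)) :=
    mul_le_mul_of_nonneg_left h8 hm₀'.le
  have h10 : m₀ * (δ * G + (∑ l, m l) * (16 * (δ * G) / m₀)) = δ * (m₀ + 16 * ∑ l, m l) * G := by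
    field_simp
  nlinarith [mul_lt_mul_of_pos_right hδ₀ hG0]

/-- A maximal clustering at a smaller scale refines a maximal clustering at a larger scale. -/
lemma IsMaxClustering.refines (hm : ∀ i, 0 < m i) (hδ : 0 < δ) {m₀ : ℝ} (hm₀' : 0 < m₀)
    (hm₀ : ∀ i, m₀ ≤ m i) (hδ₀ : δ * (m₀ + 16 * ∑ i, m i) < m₀) {μ' : ℝ} (hμ : 0 < μ)
    (hμ' : μ < μ') {A B : Clustering n} (hA : IsMaxClustering m δ μ q A)
    (hB : IsMaxClustering m δ μ' q B) (i j : Fin n) (hij : A.part i = A.part j) :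
    B.part i = B.part j := by
  by_contra hne
  have hM : 0 ≤ ∑ l, m l := Finset.sum_nonneg fun l _ => (hm l).le
  have hδ1 : δ < 1 := by nlinarith
  have hsq : μ ^ 2 < μ' ^ 2 := pow_lt_pow_left₀ hμ' hμ.le two_ne_zero
  -- Adding the two maximality inequalities cancels the inertias and leaves `(μ'² - μ²)(δ^|B| -
  -- δ^|A|) ≥ 0`.
  have hpow : δ ^ A.parts.card ≤ δ ^ B.parts.card := by
    have h1 := hA B
    have h2 := hB A
    simp only [clusterWeight] at h1 h2
    nlinarith
  have h1 := hA.norm_sub_le hm hδ hm₀' hm₀ hij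
  have h2 := hB.lt_norm_sub hm hδ (hμ.trans hμ') hm₀' hm₀ hδ₀ hne
  have h3 : 8 * μ ^ 2 * δ ^ A.parts.card ≤ 8 * μ' ^ 2 * δ ^ B.parts.card := by
    gcongr
  linarith

end Geometry

/-! ### Decay of the forces between clusters. -/

/-- The pair forces decay like `‖q‖^(-1-ε)` away from collisions. -/
def GradientBound (V : PairPotential n d) (ε r C : ℝ) : Prop :=
  ∀ i j : Fin n, i < j → ∀ q : EuclideanSpace ℝ (Fin d), r ≤ ‖q‖ →
    ‖gradient (V i j) q‖ ≤ C * ‖q‖ ^ (-1 - ε)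

lemma norm_gradient_le_of_longRangeBound {ε ε' I : ℝ} (hI : 0 < I) (hε : ε' ≤ ε)
    (h : LongRangeBound V ε I) {i j : Fin n} (hij : i < j) {q : EuclideanSpace ℝ (Fin d)}
    (hq : 1 ≤ ‖q‖) : ‖gradient (V i j) q‖ ≤ d * I * ‖q‖ ^ (-1 - ε') := by
  set g := gradient (V i j) q with hg
  have hb (b : Fin d) : |g b| ≤ I * ‖q‖ ^ (-1 - ε') := by
    have h1 := h i j hij 1 one_le_two (fun _ => b) q hq
    rw [iteratedFDeriv_one_apply] at h1
    have h2 : g b = fderiv ℝ (V i j) q (EuclideanSpace.single b 1) := by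
      rw [← InnerProductSpace.toDual_symm_apply (𝕜 := ℝ)]
      change g b = inner ℝ g _
      rw [EuclideanSpace.inner_single_right]
      simp
    rw [h2]
    refine h1.trans (mul_le_mul_of_nonneg_left (Real.rpow_le_rpow_of_exponent_le hq ?_) hI.le)
    push_cast
    linarith
  have hsum : g = ∑ b, g b • EuclideanSpace.single b (1 : ℝ) := by
    have := (EuclideanSpace.basisFun (Fin d) ℝ).sum_repr g
    simpa using this.symm
  rw [hsum]
  refine (norm_sum_le _ _).trans ?_
  calc ∑ b, ‖g b • EuclideanSpace.single b (1 : ℝ)‖ ≤ ∑ _b : Fin d, I * ‖q‖ ^ (-1 - ε') := by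
        refine Finset.sum_le_sum fun b _ => ?_
        rw [norm_smul, PiLp.norm_single, norm_one, mul_one]
        exact hb b
    _ = d * I * ‖q‖ ^ (-1 - ε') := by simp [mul_assoc]

/-- The long-range bound starts only at `‖q‖ = 1`; on the shell `r ≤ ‖q‖ ≤ 1` compactness takes
over. Small `r` is needed because separations `ℓ t` may be below `1`. -/
lemma exists_gradientBound (hV : ∀ i j : Fin n, i < j → ContDiffOn ℝ 2 (V i j) {0}ᶜ)
    {ε ε' : ℝ} (hε' : 0 < ε') (hε : ε' ≤ ε) (h : LongRangedWith V ε) {r : ℝ} (hr : 0 < r) :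
    ∃ C : ℝ, 0 ≤ C ∧ GradientBound V ε' r C := by
  obtain ⟨I, hI, h⟩ := h
  have key (i j : Fin n) : ∃ C : ℝ, 0 ≤ C ∧ (i < j → ∀ q : EuclideanSpace ℝ (Fin d), r ≤ ‖q‖ →
      ‖gradient (V i j) q‖ ≤ C * ‖q‖ ^ (-1 - ε')) := by
    by_cases hij : i < j
    · have hK : IsCompact (Metric.closedBall (0 : EuclideanSpace ℝ (Fin d)) 1 ∩ {q | r ≤ ‖q‖}) :=
        (isCompact_closedBall _ _).inter_right (isClosed_le continuous_const continuous_norm)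
      obtain ⟨C, hC⟩ := hK.exists_bound_of_continuousOn (f := gradient (V i j)) fun q hq =>
        (contDiffAt_gradient (hV i j hij)
          (norm_pos_iff.1 (hr.trans_le hq.2))).continuousAt.continuousWithinAt
      refine ⟨max C (d * I), le_max_of_le_right (by positivity), fun _ q hq => ?_⟩
      have hq0 : 0 < ‖q‖ := hr.trans_le hq
      have hpos : 0 < ‖q‖ ^ (-1 - ε') := Real.rpow_pos_of_pos hq0 _
      rcases le_total 1 ‖q‖ with h1 | h1
      · exact (norm_gradient_le_of_longRangeBound hI hε h hij h1).trans
          (mul_le_mul_of_nonneg_right (le_max_right _ _) hpos.le)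
      · have h2 : 1 ≤ ‖q‖ ^ (-1 - ε') :=
          Real.one_le_rpow_of_pos_of_le_one_of_nonpos hq0 h1 (by linarith)
        have h3 := hC q ⟨by simpa using h1, hq⟩
        have h4 : (0 : ℝ) ≤ max C (d * I) := le_max_of_le_right (by positivity)
        nlinarith [le_max_left C (d * I)]
    · exact ⟨0, le_rfl, fun h => absurd h hij⟩
  choose C hC0 hC using key
  refine ⟨∑ i, ∑ j, C i j, Finset.sum_nonneg fun i _ => Finset.sum_nonneg fun j _ => hC0 i j,
    fun i j hij q hq => (hC i j hij q hq).trans (mul_le_mul_of_nonneg_right ?_ (by positivity))⟩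
  exact (Finset.single_le_sum (f := fun j => C i j) (fun j _ => hC0 i j) (Finset.mem_univ j)).trans
    (Finset.single_le_sum (f := fun i => ∑ j, C i j)
      (fun i _ => Finset.sum_nonneg fun j _ => hC0 i j) (Finset.mem_univ i))

/-- The power of the forces along a velocity `y`. -/
lemma sum_inner_force (q y : Config n d) :
    ∑ i, inner ℝ (y i) (force V q i) =
      -∑ i, ∑ j ∈ Finset.Ioi i, inner ℝ (y i - y j) (gradient (V i j) (q i - q j)) := by
  have hswap : ∑ i, ∑ j ∈ Finset.Iio i, inner ℝ (y i) (gradient (V j i) (q j - q i)) =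
      ∑ i, ∑ j ∈ Finset.Ioi i, inner ℝ (y j) (gradient (V i j) (q i - q j)) :=
    Finset.sum_comm' (by simp)
  simp only [force, inner_sub_right, inner_sub_left, inner_sum, Finset.sum_sub_distrib, hswap]
  ring

/-- By action and reaction, pairs with `y i = y j` drop out, so arbitrarily strong forces inside
clusters do no harm. -/
lemma abs_sum_inner_force_le {ε r C s b : ℝ} (hε : 0 < ε) (hr : 0 < r) (hC : 0 ≤ C)
    (hG : GradientBound V ε r C) (hs : r ≤ s) {q y : Config n d} (hb : ∀ i, ‖y i‖ ≤ b)
    (hsep : ∀ i j, y i ≠ y j → s ≤ ‖q i - q j‖) :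
    |∑ i, inner ℝ (y i) (force V q i)| ≤ n * n * (2 * b * (C * s ^ (-1 - ε))) := by
  rw [sum_inner_force, abs_neg]
  have hs0 : 0 < s := hr.trans_le hs
  rcases isEmpty_or_nonempty (Fin n) with hn | ⟨⟨i₀⟩⟩
  · simp only [Finset.univ_eq_empty, Finset.sum_empty, abs_zero]
    have : n = 0 := by
      by_contra h0
      exact hn.elim ⟨0, Nat.pos_of_ne_zero h0⟩
    simp [this]
  have hb0 : 0 ≤ b := (norm_nonneg _).trans (hb i₀)
  have hB : 0 ≤ 2 * b * (C * s ^ (-1 - ε)) := by positivity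
  have hterm (i j : Fin n) (hij : i < j) :
      |inner ℝ (y i - y j) (gradient (V i j) (q i - q j))| ≤ 2 * b * (C * s ^ (-1 - ε)) := by
    by_cases hy : y i = y j
    · simpa [hy] using hB
    · have h1 := hsep i j hy
      have h2 := hG i j hij _ (hs.trans h1)
      have h3 : ‖q i - q j‖ ^ (-1 - ε) ≤ s ^ (-1 - ε) :=
        Real.rpow_le_rpow_of_nonpos hs0 h1 (by linarith)
      have h4 : ‖y i - y j‖ ≤ 2 * b := (norm_sub_le _ _).trans (by linarith [hb i, hb j])
      exact (abs_real_inner_le_norm _ _).trans (mul_le_mul h4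
        (h2.trans (mul_le_mul_of_nonneg_left h3 hC)) (norm_nonneg _) (by linarith))
  calc |∑ i, ∑ j ∈ Finset.Ioi i, inner ℝ (y i - y j) (gradient (V i j) (q i - q j))|
      ≤ ∑ i, ∑ j ∈ Finset.Ioi i, |inner ℝ (y i - y j) (gradient (V i j) (q i - q j))| :=
        (Finset.abs_sum_le_sum_abs _ _).trans
          (Finset.sum_le_sum fun i _ => Finset.abs_sum_le_sum_abs _ _)
    _ ≤ ∑ i : Fin n, ∑ _j ∈ Finset.Ioi i, 2 * b * (C * s ^ (-1 - ε)) :=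
        Finset.sum_le_sum fun i _ => Finset.sum_le_sum fun j hj =>
          hterm i j (Finset.mem_Ioi.1 hj)
    _ ≤ ∑ _i : Fin n, ∑ _j : Fin n, 2 * b * (C * s ^ (-1 - ε)) :=
        Finset.sum_le_sum fun i _ => Finset.sum_le_sum_of_subset_of_nonneg
          (Finset.subset_univ _) fun _ _ _ => hB
    _ = n * n * (2 * b * (C * s ^ (-1 - ε))) := by simp [mul_assoc]

/-! ### Equations of motion and energy conservation. -/

/-- The velocities `q'(t,x)` along the flow line through `x`. -/
noncomputable def velocity (m : Fin n → ℝ) (V : PairPotential n d) (x : Phase n d) (t : ℝ) :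
    Config n d :=
  fun i => (m i)⁻¹ • (flow m V t x).1 i

section Flow

variable {x : Phase n d} {t : ℝ}

lemma hasDerivAt_position (hV : ∀ i j : Fin n, i < j → ContDiffOn ℝ 2 (V i j) {0}ᶜ)
    (ht : t ∈ lifetime m V x) :
    HasDerivAt (position m V x) (velocity m V x t) t :=
  (hasDerivAt_flow hV ht).snd

lemma hasDerivAt_velocity (hV : ∀ i j : Fin n, i < j → ContDiffOn ℝ 2 (V i j) {0}ᶜ)
    (ht : t ∈ lifetime m V x) :
    HasDerivAt (velocity m V x) (fun i => (m i)⁻¹ • force V (position m V x t) i) t :=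
  hasDerivAt_pi.2 fun i => (hasDerivAt_pi.1 (hasDerivAt_flow hV ht).fst i).fun_const_smul _

lemma hasDerivAt_massInner_position (hV : ∀ i j : Fin n, i < j → ContDiffOn ℝ 2 (V i j) {0}ᶜ)
    (ht : t ∈ lifetime m V x) (y : Config n d) :
    HasDerivAt (fun s => massInner m y (position m V x s)) (massInner m y (velocity m V x t)) t :=
  HasDerivAt.fun_sum fun i _ => by
    have h := (hasDerivAt_const t (y i)).inner ℝ
      (hasDerivAt_pi.1 (hasDerivAt_position (m := m) hV ht) i)
    simpa using h.const_mul (m i)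

lemma hasDerivAt_massInner_velocity (hV : ∀ i j : Fin n, i < j → ContDiffOn ℝ 2 (V i j) {0}ᶜ)
    (hm : ∀ i, 0 < m i) (ht : t ∈ lifetime m V x)
    (y : Config n d) : HasDerivAt (fun s => massInner m y (velocity m V x s))
      (∑ i, inner ℝ (y i) (force V (position m V x t) i)) t := by
  refine HasDerivAt.fun_sum fun i _ => ?_
  have h := ((hasDerivAt_const t (y i)).inner ℝ
    (hasDerivAt_pi.1 (hasDerivAt_velocity (m := m) hV ht) i)).const_mul (m i)
  simpa [real_inner_smul_right, (hm i).ne'] using h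

lemma hasDerivAt_potential (hV : ∀ i j : Fin n, i < j → ContDiffOn ℝ 2 (V i j) {0}ᶜ)
    (ht : t ∈ lifetime m V x) :
    HasDerivAt (fun s => potential V (position m V x s))
      (-∑ i, inner ℝ (velocity m V x t i) (force V (position m V x t) i)) t := by
  rw [sum_inner_force, neg_neg]
  refine HasDerivAt.fun_sum fun i _ => HasDerivAt.fun_sum fun j hj => ?_
  have hij : i < j := Finset.mem_Ioi.1 hj
  have hne : position m V x t i - position m V x t j ≠ 0 :=
    sub_ne_zero.2 (flow_mem_phaseSpace hV ht i j hij.ne)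
  have h1 : HasGradientAt (V i j) (gradient (V i j) (position m V x t i - position m V x t j))
      (position m V x t i - position m V x t j) :=
    (((hV i j hij).contDiffAt (isOpen_compl_singleton.mem_nhds hne)).differentiableAt
      (by norm_num)).hasGradientAt
  have hp := hasDerivAt_position (m := m) hV ht
  have h2 := h1.hasFDerivAt.comp_hasDerivAt t
    ((hasDerivAt_pi.1 hp i).sub (hasDerivAt_pi.1 hp j))
  rw [InnerProductSpace.toDual_apply_apply, real_inner_comm] at h2
  exact h2

/-- Conservation of energy. -/
lemma energy_eq (hV : ∀ i j : Fin n, i < j → ContDiffOn ℝ 2 (V i j) {0}ᶜ)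
    (hm : ∀ i, 0 < m i) (h0 : 0 ≤ t) (ht : t ∈ lifetime m V x) :
    (1 / 2) * massInner m (velocity m V x t) (velocity m V x t) +
        potential V (position m V x t) =
      (1 / 2) * massInner m (velocity m V x 0) (velocity m V x 0) +
        potential V (position m V x 0) := by
  have hder : ∀ s ∈ Icc 0 t, HasDerivAt (fun s =>
      (1 / 2) * massInner m (velocity m V x s) (velocity m V x s) +
        potential V (position m V x s)) 0 s := by
    intro s hs
    have hsl : s ∈ lifetime m V x :=
      mem_lifetime_of_mem_uIcc ht (by rwa [uIcc_of_le h0])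
    have h1 : HasDerivAt (fun s => massInner m (velocity m V x s) (velocity m V x s))
        (∑ i, 2 * inner ℝ (velocity m V x s i) (force V (position m V x s) i)) s := by
      refine HasDerivAt.fun_sum fun i _ => ?_
      have hv := hasDerivAt_pi.1 (hasDerivAt_velocity (m := m) hV hsl) i
      refine ((hv.inner ℝ hv).const_mul (m i)).congr_deriv ?_
      rw [real_inner_smul_right, real_inner_smul_left, real_inner_comm (force V _ i)]
      field_simp [(hm i).ne']
      ring
    refine ((h1.const_mul (1 / 2 : ℝ)).add (hasDerivAt_potential hV hsl)).congr_deriv ?_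
    rw [← Finset.mul_sum]
    ring
  exact constant_of_has_deriv_right_zero (HasDerivAt.continuousOn hder)
    (fun s hs => (hder s (Ico_subset_Icc_self hs)).hasDerivWithinAt) t (right_mem_Icc.2 h0)

end Flow

/-! ### Corrected linear functionals of `q(t)/t` without local maxima. -/

/-- At a critical point `k` vanishes and increases, so `h` strictly increases just after it.
Splitting off the positive factor `w` means that only `k` has to be differentiated. -/
lemma not_isLocalMax_of_hasDerivAt {h k w : ℝ → ℝ} {t k' : ℝ} (hw : ∀ᶠ u in 𝓝 t, 0 < w u)
    (hh : ∀ᶠ u in 𝓝 t, HasDerivAt h (w u * k u) u) (hk : HasDerivAt k k' t) (hk' : 0 < k') :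
    ¬ IsLocalMax h t := by
  intro hmax
  have hk0 : k t = 0 := by
    have := hmax.hasDerivAt_eq_zero hh.self_of_nhds
    exact (mul_eq_zero.1 this).resolve_left hw.self_of_nhds.ne'
  have hpos : ∀ᶠ u in 𝓝[>] t, 0 < k u := by
    have h1 := (hasDerivAt_iff_tendsto_slope.1 hk).eventually (lt_mem_nhds hk')
    have h2 := h1.filter_mono (nhdsWithin_mono t fun u (hu : t < u) => hu.ne')
    filter_upwards [h2, self_mem_nhdsWithin] with u hu htu
    rw [slope_def_field, hk0, sub_zero] at hu
    exact (div_pos_iff_of_pos_right (sub_pos.2 htu)).1 hu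
  have hall : ∀ᶠ u in 𝓝[>] t, 0 < k u ∧ 0 < w u ∧ HasDerivAt h (w u * k u) u ∧ h u ≤ h t :=
    hpos.and ((hw.filter_mono nhdsWithin_le_nhds).and
      ((hh.filter_mono nhdsWithin_le_nhds).and (Filter.Eventually.filter_mono nhdsWithin_le_nhds hmax)))
  obtain ⟨b, htb, hb⟩ := mem_nhdsGT_iff_exists_Ioo_subset.1 hall
  obtain ⟨c, hc⟩ := exists_between (mem_Ioi.1 htb)
  have hmono : StrictMonoOn h (Icc t c) := by
    refine strictMonoOn_of_deriv_pos (convex_Icc t c) (fun u hu => ?_) fun u hu => ?_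
    · rcases hu.1.eq_or_lt with rfl | htu
      · exact hh.self_of_nhds.continuousAt.continuousWithinAt
      · exact (hb ⟨htu, hu.2.trans_lt hc.2⟩).2.2.1.continuousAt.continuousWithinAt
    · rw [interior_Icc] at hu
      obtain ⟨h1, h2, h3, -⟩ := hb ⟨hu.1, hu.2.trans hc.2⟩
      rw [h3.deriv]
      exact mul_pos h2 h1
  exact absurd (hmono (left_mem_Icc.2 hc.1.le) (right_mem_Icc.2 hc.1.le) hc.1)
    (not_lt.2 (hb ⟨hc.1, hc.2⟩).2.2.2)

/-- The correction that compensates the influence of the forces between separated clusters. -/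
noncomputable def correction (K ε t : ℝ) : ℝ := -(K * t ^ (-ε))

lemma hasDerivAt_correction (K ε : ℝ) {t : ℝ} (ht : 0 < t) :
    HasDerivAt (correction K ε) (K * ε * t ^ (-1 - ε)) t := by
  refine ((Real.hasDerivAt_rpow_const (p := -ε) (Or.inl ht.ne')).const_mul K).neg.congr_deriv ?_
  rw [show -ε - 1 = -1 - ε by ring]
  ring

/-- With `t⁻²` in front, the velocity terms cancel when the bracket is differentiated, leaving `t`
times the force plus a multiple of `t^(-ε)`. -/
lemma hasDerivAt_massInner_scaled (hV : ∀ i j : Fin n, i < j → ContDiffOn ℝ 2 (V i j) {0}ᶜ)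
    {x : Phase n d} {t : ℝ} (ht : t ∈ lifetime m V x) (ht0 : 0 < t) (y : Config n d) (K ε : ℝ) :
    HasDerivAt (fun u => massInner m y (u⁻¹ • position m V x u) + correction K ε u)
      ((t ^ 2)⁻¹ * (t * massInner m y (velocity m V x t) - massInner m y (position m V x t)
        + K * ε * t ^ (1 - ε))) t := by
  simp only [massInner_smul_right]
  refine (((hasDerivAt_inv ht0.ne').mul (hasDerivAt_massInner_position (m := m) hV ht y)).add
    (hasDerivAt_correction K ε ht0)).congr_deriv ?_
  have h1 : t ^ (1 - ε) = t ^ 2 * t ^ (-1 - ε) := by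
    rw [← Real.rpow_natCast, ← Real.rpow_add ht0]
    congr 1
    push_cast
    ring
  rw [h1]
  field_simp
  ring

/-- The force term `t · (ℓ t)^(-1-ε')` has the same order `t^(-ε')` as the contribution `K ε' (1 -
ε') t^(-ε')` of the correction, which is positive as `ε' < 1`. The `+ 1` in `K` makes the domination
strict; `K` serves all orbits at once. -/
lemma exists_correction (hm : ∀ i, 0 < m i)
    (hV : ∀ i j : Fin n, i < j → ContDiffOn ℝ 2 (V i j) {0}ᶜ) {ε ε' : ℝ} (hε' : 0 < ε')
    (hε1 : ε' < 1) (hε : ε' ≤ ε) (hLR : LongRangedWith V ε) {t₀ ℓ b : ℝ} (ht₀ : 0 < t₀)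
    (hℓ : 0 < ℓ) (hb : 0 ≤ b) : ∃ K : ℝ, 0 < K ∧ ∀ x : Phase n d, ∀ t ∈ lifetime m V x, t₀ ≤ t →
      ∀ y : Config n d, (∀ i, ‖y i‖ ≤ b) →
      (∀ i j, y i ≠ y j → ℓ * t ≤ ‖position m V x t i - position m V x t j‖) →
      ¬ IsLocalMax (fun u => massInner m y (u⁻¹ • position m V x u) + correction K ε' u) t := by
  obtain ⟨C, hC, hG⟩ := exists_gradientBound hV hε' hε hLR (mul_pos hℓ ht₀)
  have hε2 : 0 < ε' * (1 - ε') := mul_pos hε' (by linarith)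
  refine ⟨(n * n * (2 * b * (C * ℓ ^ (-1 - ε'))) + 1) / (ε' * (1 - ε')), by positivity,
    fun x t ht htt y hy hsep => ?_⟩
  set K := (n * n * (2 * b * (C * ℓ ^ (-1 - ε'))) + 1) / (ε' * (1 - ε')) with hK
  have ht0 : 0 < t := ht₀.trans_le htt
  have hpos : ∀ᶠ u in 𝓝 t, 0 < u := lt_mem_nhds ht0
  refine not_isLocalMax_of_hasDerivAt (w := fun u => (u ^ 2)⁻¹)
    (k := fun u => u * massInner m y (velocity m V x u) - massInner m y (position m V x u)
        + K * ε' * u ^ (1 - ε'))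
    (k' := t * ∑ i, inner ℝ (y i) (force V (position m V x t) i)
      + K * (ε' * (1 - ε')) * t ^ (-ε')) ?_ ?_ ?_ ?_
  · filter_upwards [hpos] with u hu using by positivity
  · filter_upwards [hpos, lifetime_mem_nhds ht] with u hu hul
    exact hasDerivAt_massInner_scaled hV hul hu y K ε'
  · refine ((((hasDerivAt_id t).mul (hasDerivAt_massInner_velocity hV hm ht y)).sub
      (hasDerivAt_massInner_position (m := m) hV ht y)).add
      ((Real.hasDerivAt_rpow_const (p := 1 - ε')
        (Or.inl ht0.ne')).const_mul (K * ε'))).congr_deriv ?_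
    rw [show 1 - ε' - 1 = -ε' by ring]
    simp only [id]
    ring
  · have h1 := abs_sum_inner_force_le hε' (mul_pos hℓ ht₀) hC hG
      (mul_le_mul_of_nonneg_left htt hℓ.le) hy hsep
    have h2 : t * (n * n * (2 * b * (C * (ℓ * t) ^ (-1 - ε')))) =
        n * n * (2 * b * (C * ℓ ^ (-1 - ε'))) * t ^ (-ε') := by
      rw [Real.mul_rpow hℓ.le ht0.le, show -ε' = 1 + (-1 - ε') by ring, Real.rpow_add ht0,
        Real.rpow_one]
      ring
    have h3 : K * (ε' * (1 - ε')) = n * n * (2 * b * (C * ℓ ^ (-1 - ε'))) + 1 :=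
      div_mul_cancel₀ _ hε2.ne'
    have h4 := mul_le_mul_of_nonneg_left (neg_le_of_abs_le h1) ht0.le
    rw [h3]
    have h5 : 0 < t ^ (-ε') := Real.rpow_pos_of_pos ht0 _
    rw [mul_neg, h2] at h4
    linarith

/-! ### The Graf norm and its quasi-convexity along orbits. -/

/-- The maximum over all clusterings of the square root of the cluster weight. -/
noncomputable def grafNorm (m : Fin n → ℝ) (δ μ : ℝ) (q : Config n d) : ℝ :=
  (Finset.univ : Finset (Clustering n)).sup' ⟨⊥, Finset.mem_univ _⟩
    fun C => √(clusterWeight m δ μ C q)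

section GrafNorm

variable {δ μ : ℝ} {q : Config n d} {C : Clustering n}

lemma sqrt_clusterWeight_le_grafNorm (m : Fin n → ℝ) (δ μ : ℝ) (C : Clustering n)
    (q : Config n d) : √(clusterWeight m δ μ C q) ≤ grafNorm m δ μ q :=
  Finset.le_sup' (fun C => √(clusterWeight m δ μ C q)) (Finset.mem_univ C)

lemma IsMaxClustering.grafNorm_eq (h : IsMaxClustering m δ μ q C) :
    grafNorm m δ μ q = √(clusterWeight m δ μ C q) :=
  le_antisymm (Finset.sup'_le _ _ fun C' _ => Real.sqrt_le_sqrt (h C'))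
    (sqrt_clusterWeight_le_grafNorm m δ μ C q)

lemma continuous_grafNorm : Continuous (grafNorm (d := d) m δ μ) := by
  refine Continuous.finset_sup'_apply _ fun C _ => Real.continuous_sqrt.comp ?_
  exact (continuous_massInner.comp ((continuous_extProj C).prodMk (continuous_extProj C))).add
    continuous_const

lemma clusterWeight_pos (hm : ∀ i, 0 < m i) (hδ : 0 < δ) (hμ : 0 < μ) (C : Clustering n)
    (q : Config n d) : 0 < clusterWeight m δ μ C q :=
  add_pos_of_nonneg_of_pos (massInner_self_nonneg hm _) (by positivity)

lemma grafNorm_pos (hm : ∀ i, 0 < m i) (hδ : 0 < δ) (hμ : 0 < μ) (q : Config n d) :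
    0 < grafNorm m δ μ q :=
  (Real.sqrt_pos.2 (clusterWeight_pos hm hδ hμ ⊥ q)).trans_le
    (sqrt_clusterWeight_le_grafNorm m δ μ ⊥ q)

lemma sqrt_massInner_le_grafNorm (hm : ∀ i, 0 < m i) (hδ : 0 < δ) (q : Config n d) :
    √(massInner m q q) ≤ grafNorm m δ μ q := by
  refine le_trans (Real.sqrt_le_sqrt ?_) (sqrt_clusterWeight_le_grafNorm m δ μ ⊥ q)
  rw [clusterWeight, massInner_extProj_bot hm]
  exact le_add_of_nonneg_right (by positivity)

/-- With `sqrt_massInner_le_grafNorm`, this lets the Graf norm replace the mass norm up to an error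
controlled by `μ`. -/
lemma grafNorm_le (hm : ∀ i, 0 < m i) (hδ : 0 < δ) (hδ1 : δ ≤ 1) (hμ : 0 < μ) (q : Config n d) :
    grafNorm m δ μ q ≤ √(massInner m q q) + 2 * μ := by
  refine Finset.sup'_le _ _ fun C _ => Real.sqrt_le_iff.2 ⟨by positivity, ?_⟩
  have h1 : δ ^ C.parts.card ≤ 1 := pow_le_one₀ hδ.le hδ1
  have h2 := massInner_extProj_le hm C q
  have h3 := Real.sq_sqrt (massInner_self_nonneg hm q)
  have h4 := Real.sqrt_nonneg (massInner m q q)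
  have h5 : 2 * μ ^ 2 * δ ^ C.parts.card ≤ 2 * μ ^ 2 * 1 :=
    mul_le_mul_of_nonneg_left h1 (by positivity)
  rw [clusterWeight]
  nlinarith [mul_nonneg h4 hμ.le]

/-- The Cauchy-Schwarz inequality behind the convexity of `grafNorm`. -/
lemma massInner_extProj_add_le (hm : ∀ i, 0 < m i) (hδ : 0 < δ) (hμ : 0 < μ) (C : Clustering n)
    (q q' : Config n d) :
    massInner m (extProj m C q) q' + 2 * μ ^ 2 * δ ^ C.parts.card ≤
      √(clusterWeight m δ μ C q) * √(clusterWeight m δ μ C q') := by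
  set a := √(clusterWeight m δ μ C q) with ha
  set a' := √(clusterWeight m δ μ C q') with ha'
  set c := 2 * μ ^ 2 * δ ^ C.parts.card with hc
  have hc0 : 0 < c := by positivity
  have ha0 : 0 < a := Real.sqrt_pos.2 (clusterWeight_pos hm hδ hμ C q)
  have ha0' : 0 < a' := Real.sqrt_pos.2 (clusterWeight_pos hm hδ hμ C q')
  have h1 : a ^ 2 = massInner m (extProj m C q) (extProj m C q) + c :=
    Real.sq_sqrt (clusterWeight_pos hm hδ hμ C q).le
  have h1' : a' ^ 2 = massInner m (extProj m C q') (extProj m C q') + c :=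
    Real.sq_sqrt (clusterWeight_pos hm hδ hμ C q').le
  have h2 : massInner m (extProj m C q) q' = massInner m (extProj m C q) (extProj m C q') := by
    rw [massInner_comm _ (extProj m C q'), massInner_extProj_left hm (blockConst_extProj C q),
      massInner_comm]
  -- Cauchy-Schwarz for the vectors `(q^E, √c)` and `(q'^E, √c)`, of lengths `a` and `a'`: `h3` is
  -- the first component of the square, `h5` the second.
  have h3 := massInner_self_nonneg hm (a' • extProj m C q - a • extProj m C q')
  simp only [massInner_sub_left, massInner_sub_right, massInner_smul_left,
    massInner_smul_right] at h3
  rw [massInner_comm (extProj m C q') (extProj m C q)] at h3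
  rw [h2]
  set X := massInner m (extProj m C q) (extProj m C q')
  have h4 : a' ^ 2 * (a ^ 2 - c) - 2 * (a * a') * X + a ^ 2 * (a' ^ 2 - c) ≥ 0 := by
    rw [eq_sub_of_add_eq h1.symm, eq_sub_of_add_eq h1'.symm] at h3
    linarith
  have h5 : 0 ≤ c * (a - a') ^ 2 := by positivity
  have h6 : 2 * (a * a') * (X + c) ≤ 2 * (a * a') * (a * a') := by nlinarith
  exact le_of_mul_le_mul_left h6 (by positivity)

end GrafNorm

/-- The Graf norm of the rescaled positions `q(t,x)/t`, corrected for the forces between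
separated clusters. -/
noncomputable def correctedNorm (m : Fin n → ℝ) (V : PairPotential n d) (δ μ K ε : ℝ)
    (x : Phase n d) (t : ℝ) : ℝ :=
  grafNorm m δ μ (t⁻¹ • position m V x t) + correction K ε t

lemma continuousAt_scaledPosition (hV : ∀ i j : Fin n, i < j → ContDiffOn ℝ 2 (V i j) {0}ᶜ)
    {x : Phase n d} {t : ℝ} (ht : t ∈ lifetime m V x) (ht0 : 0 < t) :
    ContinuousAt (fun s => s⁻¹ • position m V x s) t :=
  (continuousAt_inv₀ ht0.ne').smul (hasDerivAt_position hV ht).continuousAt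

lemma continuousAt_correctedNorm (hV : ∀ i j : Fin n, i < j → ContDiffOn ℝ 2 (V i j) {0}ᶜ)
    (δ μ K ε : ℝ) {x : Phase n d} {t : ℝ} (ht : t ∈ lifetime m V x) (ht0 : 0 < t) :
    ContinuousAt (correctedNorm m V δ μ K ε x) t :=
  (continuous_grafNorm.continuousAt.comp (continuousAt_scaledPosition hV ht ht0)).add
    (hasDerivAt_correction K ε ht0).continuousAt

/-- The functional of `q(u,x)/u` that supports `grafNorm` from below at time `t`. -/
lemma support_correctedNorm (hm : ∀ i, 0 < m i) {δ μ : ℝ} (hδ : 0 < δ) (hμ : 0 < μ) (K ε : ℝ)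
    {x : Phase n d} {t : ℝ} {B : Clustering n}
    (hB : IsMaxClustering m δ μ (t⁻¹ • position m V x t) B) {y : Config n d} {N c : ℝ}
    (hN : N = grafNorm m δ μ (t⁻¹ • position m V x t))
    (hy : y = N⁻¹ • extProj m B (t⁻¹ • position m V x t))
    (hc : c = N⁻¹ * (2 * μ ^ 2 * δ ^ B.parts.card)) :
    (∀ u, massInner m y (u⁻¹ • position m V x u) + correction K ε u + c ≤
      correctedNorm m V δ μ K ε x u) ∧
    massInner m y (t⁻¹ • position m V x t) + correction K ε t + c =
      correctedNorm m V δ μ K ε x t := by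
  have hN0 : 0 < N := hN ▸ grafNorm_pos hm hδ hμ _
  have hNB : N = √(clusterWeight m δ μ B (t⁻¹ • position m V x t)) := hN.trans hB.grafNorm_eq
  constructor
  · intro u
    have h1 := massInner_extProj_add_le hm hδ hμ B (t⁻¹ • position m V x t) (u⁻¹ • position m V x u)
    rw [← hNB] at h1
    have h2 := sqrt_clusterWeight_le_grafNorm m δ μ B (u⁻¹ • position m V x u)
    have h3 : N⁻¹ * (massInner m (extProj m B (t⁻¹ • position m V x t)) (u⁻¹ • position m V x u) +
        2 * μ ^ 2 * δ ^ B.parts.card) ≤ grafNorm m δ μ (u⁻¹ • position m V x u) := by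
      rw [inv_mul_le_iff₀ hN0]
      exact h1.trans (mul_le_mul_of_nonneg_left h2 hN0.le)
    rw [correctedNorm, hy, hc, massInner_smul_left]
    linarith
  · have h1 : massInner m (extProj m B (t⁻¹ • position m V x t)) (t⁻¹ • position m V x t) +
        2 * μ ^ 2 * δ ^ B.parts.card = N ^ 2 := by
      rw [hNB, Real.sq_sqrt (clusterWeight_pos hm hδ hμ _ _).le, clusterWeight,
        massInner_extProj_left hm (blockConst_extProj B _), massInner_comm]
    have h2 : N⁻¹ * (massInner m (extProj m B (t⁻¹ • position m V x t)) (t⁻¹ • position m V x t) +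
        2 * μ ^ 2 * δ ^ B.parts.card) = N := by
      rw [h1]; field_simp
    rw [correctedNorm, hy, hc, massInner_smul_left, ← hN]
    linarith

/-- Quasi-convexity of the corrected norm along orbits. -/
lemma exists_quasiconvex_correctedNorm (hm : ∀ i, 0 < m i)
    (hV : ∀ i j : Fin n, i < j → ContDiffOn ℝ 2 (V i j) {0}ᶜ) {ε ε' : ℝ} (hε' : 0 < ε')
    (hε1 : ε' < 1) (hε : ε' ≤ ε) (hLR : LongRangedWith V ε) {m₀ : ℝ} (hm₀' : 0 < m₀)
    (hm₀ : ∀ i, m₀ ≤ m i) {δ μ t₀ : ℝ} (hδ : 0 < δ) (hδ₀ : δ * (m₀ + 16 * ∑ i, m i) < m₀)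
    (hμ : 0 < μ) (ht₀ : 0 < t₀) :
    ∃ K : ℝ, 0 < K ∧ ∀ (x : Phase n d) (a b : ℝ), t₀ ≤ a → b ∈ lifetime m V x → ∀ t ∈ Icc a b,
      correctedNorm m V δ μ K ε' x t ≤
        max (correctedNorm m V δ μ K ε' x a) (correctedNorm m V δ μ K ε' x b) := by
  have hM : 0 ≤ ∑ l, m l := Finset.sum_nonneg fun l _ => (hm l).le
  have hδ1 : δ ≤ 1 := by nlinarith
  -- A separation valid for every maximal clustering, since there are at most `n` blocks and `δ ≤
  -- 1`.
  set ℓ := √(8 * μ ^ 2 * δ ^ n / m₀) with hℓ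
  have hℓ0 : 0 < ℓ := Real.sqrt_pos.2 (by positivity)
  obtain ⟨K, hK, hmax⟩ := exists_correction (d := d) hm hV hε' hε1 hε hLR ht₀ hℓ0
    (b := √(1 / m₀)) (Real.sqrt_nonneg _)
  refine ⟨K, hK, fun x a b ha hb t ht => ?_⟩
  have hab : a ≤ b := ht.1.trans ht.2
  have hlife : ∀ s ∈ Icc a b, s ∈ lifetime m V x ∧ 0 < s := fun s hs =>
    have hs0 : 0 < s := ht₀.trans_le (ha.trans hs.1)
    ⟨mem_lifetime_of_mem_uIcc hb (mem_uIcc_of_le hs0.le hs.2), hs0⟩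
  obtain ⟨s, hs, hsmax⟩ := isCompact_Icc.exists_isMaxOn (nonempty_Icc.2 hab)
    (f := correctedNorm m V δ μ K ε' x) fun s hs =>
      (continuousAt_correctedNorm hV δ μ K ε' (hlife s hs).1 (hlife s hs).2).continuousWithinAt
  refine (hsmax ht).trans ?_
  rcases hs.1.eq_or_lt with rfl | has
  · exact le_max_left _ _
  rcases hs.2.eq_or_lt with rfl | hsb
  · exact le_max_right _ _
  exfalso
  -- The supporting functional lies below the corrected norm and touches it at `s`, so it would
  -- inherit the local maximum, against the choice of `K`.
  have hloc : IsLocalMax (correctedNorm m V δ μ K ε' x) s := hsmax.isLocalMax (Icc_mem_nhds has hsb)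
  obtain ⟨B, hB⟩ := exists_isMaxClustering m δ μ (s⁻¹ • position m V x s)
  obtain ⟨hs1, hs0⟩ := hlife s hs
  set N := grafNorm m δ μ (s⁻¹ • position m V x s) with hN
  have hN0 : 0 < N := grafNorm_pos hm hδ hμ _
  set y := N⁻¹ • extProj m B (s⁻¹ • position m V x s) with hy
  obtain ⟨hle, heq⟩ := support_correctedNorm hm hδ hμ K ε' hB hN hy rfl
  refine hmax x s hs1 (ha.trans hs.1) y (fun i => ?_) (fun i j hij => ?_) ?_
  · have h1 := mul_norm_sq_le_massInner hm y i
    have h2 : massInner m y y ≤ 1 := by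
      rw [hy, massInner_smul_left, massInner_smul_right]
      have h3 : massInner m (extProj m B (s⁻¹ • position m V x s))
          (extProj m B (s⁻¹ • position m V x s)) ≤ N ^ 2 := by
        rw [hN, hB.grafNorm_eq, Real.sq_sqrt (clusterWeight_pos hm hδ hμ _ _).le, clusterWeight]
        exact le_add_of_nonneg_right (by positivity)
      calc _ ≤ N⁻¹ * (N⁻¹ * N ^ 2) := by gcongr
        _ = 1 := by field_simp
    refine Real.le_sqrt_of_sq_le ?_
    rw [le_div_iff₀ hm₀']
    nlinarith [mul_le_mul_of_nonneg_right (hm₀ i) (sq_nonneg ‖y i‖)]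
  · have hne : B.part i ≠ B.part j := fun h => hij (by
      simp only [hy, Pi.smul_apply, blockConst_extProj B _ i j h])
    have h1 := hB.lt_norm_sub hm hδ hμ hm₀' hm₀ hδ₀ hne
    have h2 : δ ^ n ≤ δ ^ B.parts.card :=
      pow_le_pow_of_le_one hδ.le hδ1 (by simpa using B.card_parts_le_card)
    simp only [Pi.smul_apply] at h1
    rw [← smul_sub, norm_smul, norm_inv, Real.norm_of_nonneg hs0.le] at h1
    have h3 : 8 * μ ^ 2 * δ ^ n / m₀ ≤ (s⁻¹ * ‖position m V x s i - position m V x s j‖) ^ 2 := by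
      rw [div_le_iff₀ hm₀', mul_comm _ m₀]
      refine le_trans ?_ h1.le
      gcongr
    have h4 := Real.sqrt_le_iff.2 ⟨by positivity, h3⟩
    rw [← hℓ] at h4
    calc ℓ * s ≤ s⁻¹ * ‖position m V x s i - position m V x s j‖ * s := by gcongr
      _ = _ := by field_simp
  · filter_upwards [hloc] with u hu
    linarith [hle u]

/-! ### Limits at the escape time. -/

lemma eventually_toEscape (hV : ∀ i j : Fin n, i < j → ContDiffOn ℝ 2 (V i j) {0}ᶜ)
    {x : Phase n d} (hx : x ∈ phaseSpace n d) {a : ℝ} (ha0 : 0 ≤ a)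
    (ha : (a : EReal) < escapeTime m V x) :
    ∀ᶠ t in toEscape m V x, a < t ∧ t ∈ lifetime m V x :=
  (toEscape_hasBasis hV hx).mem_of_mem ha |> mem_of_superset <| fun _ ht =>
    ⟨ht.1, mem_lifetime_of_nonneg (ha0.trans ht.1.le) ht.2⟩

lemma exists_pos_lt_escapeTime (hV : ∀ i j : Fin n, i < j → ContDiffOn ℝ 2 (V i j) {0}ᶜ)
    {x : Phase n d} (hx : x ∈ phaseSpace n d) :
    ∃ t₀ : ℝ, 0 < t₀ ∧ (t₀ : EReal) < escapeTime m V x := by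
  obtain ⟨t, h1, h2⟩ := EReal.lt_iff_exists_real_btwn.1 (escapeTime_pos (m := m) hV hx)
  exact ⟨t, by exact_mod_cast h1, h2⟩

/-- Continuity at a finite escape time, decay to `0` at an infinite one. The correction thus affects
neither convergence nor divergence. -/
lemma tendsto_correction (hV : ∀ i j : Fin n, i < j → ContDiffOn ℝ 2 (V i j) {0}ᶜ)
    {x : Phase n d} (hx : x ∈ phaseSpace n d) (K : ℝ) {ε : ℝ} (hε : 0 < ε) :
    ∃ l : ℝ, Tendsto (correction K ε) (toEscape m V x) (𝓝 l) := by
  have hT0 := escapeTime_pos (m := m) hV hx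
  have hB := toEscape_hasBasis (m := m) hV hx
  induction hT : escapeTime m V x with
  | bot => simp [hT] at hT0
  | coe T =>
    rw [hT] at hT0 hB
    have hT0' : 0 < T := by exact_mod_cast hT0
    refine ⟨correction K ε T, (hasDerivAt_correction K ε hT0').continuousAt.tendsto.mono_left ?_⟩
    intro s hs
    obtain ⟨a, haT, ha⟩ := exists_Ioc_subset_of_mem_nhds hs ⟨0, hT0'⟩
    exact hB.mem_iff.2 ⟨a, by exact_mod_cast haT, fun t ht => ha ⟨ht.1, by
      have := ht.2; exact (EReal.coe_lt_coe_iff.1 this).le⟩⟩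
  | top =>
    have hle : toEscape m V x ≤ atTop := by
      refine atTop_basis_Ioi.ge_iff.2 fun a _ => hB.mem_iff.2 ⟨a, ?_, fun t ht => ht.1⟩
      rw [hT]
      exact EReal.coe_lt_top a
    have h := ((tendsto_rpow_neg_atTop hε).const_mul K).neg
    exact ⟨_, h.mono_left hle⟩

section Limits

variable {x : Phase n d}

/-- Existence of the limit of `J(q(t,x)/t)` in `[0,∞]`. -/
lemma exists_tendsto_scaledInertia (hm : ∀ i, 0 < m i) (hV : IsLongRanged V)
    (hx : x ∈ phaseSpace n d) :
    ∃ L : ENNReal, Tendsto (scaledInertia m V x) (toEscape m V x) (𝓝 L) := by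
  obtain ⟨hV, ε, hε, hLR⟩ := hV
  obtain ⟨m₀, hm₀', hm₀⟩ := exists_mass_lower_bound hm
  have hM : 0 ≤ ∑ l, m l := Finset.sum_nonneg fun l _ => (hm l).le
  obtain ⟨t₀, ht₀, ht₀T⟩ := exists_pos_lt_escapeTime (m := m) hV hx
  refine tendsto_of_no_upcrossings dense_univ ?_
  rintro a - b - hab ⟨hfa, hfb⟩
  have hb : b ≠ ⊤ := by
    rintro rfl
    obtain ⟨t, ht⟩ := hfb.exists
    exact absurd ht not_top_lt
  set A := √(2 * a.toReal) with hA
  set B := √(2 * b.toReal) with hB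
  have hAB : A < B := Real.sqrt_lt_sqrt (by positivity)
    (by linarith [(ENNReal.toReal_lt_toReal hab.ne_top hb).2 hab])
  have hfa' : ∃ᶠ t in toEscape m V x,
      √(massInner m (t⁻¹ • position m V x t) (t⁻¹ • position m V x t)) ≤ A := by
    refine hfa.mono fun t ht => Real.sqrt_le_sqrt ?_
    rw [scaledInertia, ENNReal.ofReal_lt_iff_lt_toReal ?_ hab.ne_top, inertia_eq] at ht
    · linarith
    · rw [inertia_eq]
      linarith [massInner_self_nonneg hm (t⁻¹ • position m V x t)]
  have hfb' : ∃ᶠ t in toEscape m V x,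
      B ≤ √(massInner m (t⁻¹ • position m V x t) (t⁻¹ • position m V x t)) := by
    refine hfb.mono fun t ht => Real.sqrt_le_sqrt ?_
    rw [scaledInertia, ENNReal.lt_ofReal_iff_toReal_lt hb, inertia_eq] at ht
    linarith
  -- With `μ = η/2` the Graf norm errs by at most `η`, and the correction varies by less than
  -- `3η/2`. Together this is less than the gap `4η`.
  set η := (B - A) / 4 with hη
  have hη0 : 0 < η := by rw [hη]; linarith
  set δ := m₀ / (m₀ + 16 * ∑ i, m i) / 2 with hδ
  have hδ0 : 0 < δ := by positivity
  have hδ₀ : δ * (m₀ + 16 * ∑ i, m i) < m₀ := by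
    have : δ * (m₀ + 16 * ∑ i, m i) = m₀ / 2 := by rw [hδ]; field_simp
    linarith
  have hδ1 : δ ≤ 1 := by nlinarith
  have hε' : 0 < min ε (1 / 2) := lt_min hε (by norm_num)
  obtain ⟨K, hK, hqc⟩ := exists_quasiconvex_correctedNorm (d := d) hm hV hε'
    ((min_le_right _ _).trans_lt (by norm_num)) (min_le_left _ _) hLR hm₀' hm₀ hδ0 hδ₀
    (half_pos hη0) ht₀
  obtain ⟨l, hl⟩ := tendsto_correction (m := m) hV hx K hε'
  have hev : ∀ᶠ t in toEscape m V x, (t₀ < t ∧ t ∈ lifetime m V x) ∧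
      (l - η < correction K (min ε (1 / 2)) t ∧ correction K (min ε (1 / 2)) t < l + η / 2) :=
    (eventually_toEscape hV hx ht₀.le ht₀T).and
      (hl.eventually (Ioo_mem_nhds (by linarith) (by linarith)))
  -- Times `α < β < γ` with mass norm low, high, low: this contradicts quasi-convexity.
  obtain ⟨α, hα, ⟨hα0, hαl⟩, -, hαφ⟩ := (hfa'.and_eventually hev).exists
  obtain ⟨β, ⟨hβ, ⟨hβ0, hβl⟩, hβφ, -⟩, hαβ, -⟩ := ((hfb'.and_eventually hev).and_eventually
    (eventually_toEscape hV hx (ht₀.trans hα0).le (lt_escapeTime_of_mem_lifetime hαl))).exists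
  obtain ⟨γ, ⟨hγ, ⟨hγ0, hγl⟩, -, hγφ⟩, hβγ, -⟩ := ((hfa'.and_eventually hev).and_eventually
    (eventually_toEscape hV hx (ht₀.trans hβ0).le (lt_escapeTime_of_mem_lifetime hβl))).exists
  have key := hqc x α γ hα0.le hγl β ⟨hαβ.le, hβγ.le⟩
  simp only [correctedNorm] at key
  have h1 := grafNorm_le hm hδ0 hδ1 (half_pos hη0) (α⁻¹ • position m V x α)
  have h2 := grafNorm_le hm hδ0 hδ1 (half_pos hη0) (γ⁻¹ • position m V x γ)
  have h3 := sqrt_massInner_le_grafNorm (μ := η / 2) hm hδ0 (β⁻¹ • position m V x β)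
  rcases le_max_iff.1 key with h | h <;> linarith

lemma eventually_forall_ge_toEscape (hV : ∀ i j : Fin n, i < j → ContDiffOn ℝ 2 (V i j) {0}ᶜ)
    (hx : x ∈ phaseSpace n d) {p : ℝ → Prop} (hp : ∀ᶠ t in toEscape m V x, p t) :
    ∀ᶠ t in toEscape m V x, ∀ s ∈ lifetime m V x, t ≤ s → p s := by
  obtain ⟨a, ha, h⟩ := (toEscape_hasBasis hV hx).eventually_iff.1 hp
  exact (toEscape_hasBasis hV hx).eventually_iff.2 ⟨a, ha, fun t ht s hs hts =>
    h ⟨ht.1.trans_le hts, lt_escapeTime_of_mem_lifetime hs⟩⟩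

lemma exists_mapClusterPt_scaledPosition (hm : ∀ i, 0 < m i)
    (hV : ∀ i j : Fin n, i < j → ContDiffOn ℝ 2 (V i j) {0}ᶜ) (hx : x ∈ phaseSpace n d) {L : ℝ}
    (hS : Tendsto (fun t : ℝ => massInner m (t⁻¹ • position m V x t) (t⁻¹ • position m V x t))
      (toEscape m V x) (𝓝 L)) :
    ∃ v : Config n d, massInner m v v = L ∧
      MapClusterPt v (toEscape m V x) (fun t : ℝ => t⁻¹ • position m V x t) := by
  obtain ⟨m₀, hm₀', hm₀⟩ := exists_mass_lower_bound hm
  have hne := toEscape_neBot (m := m) hV hx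
  have hbd : ∀ᶠ t : ℝ in toEscape m V x,
      t⁻¹ • position m V x t ∈ Metric.closedBall (0 : Config n d) (√((L + 1) / m₀)) := by
    filter_upwards [hS.eventually (gt_mem_nhds (show L < L + 1 by linarith))] with t ht
    rw [mem_closedBall_zero_iff, pi_norm_le_iff_of_nonneg (Real.sqrt_nonneg _)]
    intro i
    refine Real.le_sqrt_of_sq_le ?_
    rw [le_div_iff₀ hm₀']
    nlinarith [mul_norm_sq_le_massInner hm (t⁻¹ • position m V x t) i,
      mul_le_mul_of_nonneg_right (hm₀ i) (sq_nonneg ‖(t⁻¹ • position m V x t) i‖)]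
  obtain ⟨v, -, hv⟩ := (isCompact_closedBall (0 : Config n d)
    (√((L + 1) / m₀))).exists_mapClusterPt (tendsto_principal.2 hbd)
  refine ⟨v, ?_, hv⟩
  have hc : Continuous fun q : Config n d => massInner m q q :=
    continuous_massInner.comp (continuous_id.prodMk continuous_id)
  have h1 := hv.continuousAt_comp (f := fun q => massInner m q q) hc.continuousAt
  have h2 : (𝓝 (massInner m v v) ⊓ 𝓝 L).NeBot := NeBot.mono h1 (inf_le_inf_left _ hS)
  exact eq_of_nhds_neBot h2

/-- The factor `2` leaves room to move each particle by `ℓ / 2` and keep distance `ℓ`. -/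
lemma exists_separation (v : Config n d) :
    ∃ ℓ : ℝ, 0 < ℓ ∧ ∀ i j, v i ≠ v j → 2 * ℓ ≤ ‖v i - v j‖ := by
  rcases isEmpty_or_nonempty {p : Fin n × Fin n // v p.1 ≠ v p.2} with he | he
  · exact ⟨1, one_pos, fun i j hij => he.elim ⟨(i, j), hij⟩⟩
  · obtain ⟨⟨⟨i, j⟩, hij⟩, hmin⟩ := Finite.exists_min
      fun p : {p : Fin n × Fin n // v p.1 ≠ v p.2} => ‖v p.1.1 - v p.1.2‖
    refine ⟨‖v i - v j‖ / 2, half_pos (norm_pos_iff.2 (sub_ne_zero.2 hij)), fun k l hkl => ?_⟩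
    have := hmin ⟨(k, l), hkl⟩
    simp only at this
    linarith

lemma norm_sub_lt_of_massInner_lt (hm : ∀ i, 0 < m i) {m₀ : ℝ} (hm₀' : 0 < m₀)
    (hm₀ : ∀ i, m₀ ≤ m i) {q v : Config n d} {c : ℝ} (hc : 0 < c)
    (h : massInner m (q - v) (q - v) < m₀ * c ^ 2) (i : Fin n) : ‖q i - v i‖ < c := by
  have h1 := ((mul_le_mul_of_nonneg_right (hm₀ i) (sq_nonneg ‖(q - v) i‖)).trans
    (mul_norm_sq_le_massInner hm (q - v) i)).trans_lt h
  exact lt_of_pow_lt_pow_left₀ 2 hc.le (lt_of_mul_lt_mul_left h1 hm₀'.le)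

lemma eventually_massInner_sub_self_lt (v : Config n d) {c : ℝ} (hc : 0 < c) :
    ∀ᶠ q in 𝓝 v, massInner m (q - v) (q - v) < c := by
  have h2 : Continuous fun q : Config n d => massInner m (q - v) (q - v) := by
    unfold massInner
    fun_prop
  have h3 : massInner m (v - v) (v - v) < c := by simpa [massInner] using hc
  exact h2.continuousAt.eventually_lt continuousAt_const h3

/-- A limit point `v` of `q(t,x)/t` is the limit if the norm of `q(t,x)/t` converges. -/
lemma eventually_massInner_sub_lt (hm : ∀ i, 0 < m i) (hV : IsLongRanged V)
    (hx : x ∈ phaseSpace n d) {v : Config n d}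
    (hS : Tendsto (fun t : ℝ => massInner m (t⁻¹ • position m V x t) (t⁻¹ • position m V x t))
      (toEscape m V x) (𝓝 (massInner m v v)))
    (hv : MapClusterPt v (toEscape m V x) (fun t : ℝ => t⁻¹ • position m V x t)) {m₀ : ℝ}
    (hm₀' : 0 < m₀) (hm₀ : ∀ i, m₀ ≤ m i) {ℓ : ℝ} (hℓ0 : 0 < ℓ)
    (hℓ : ∀ i j, v i ≠ v j → 2 * ℓ ≤ ‖v i - v j‖) {ρ : ℝ} (hρ0 : 0 < ρ)
    (hρ : ρ ≤ m₀ * (ℓ / 2) ^ 2) :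
    ∀ᶠ t : ℝ in toEscape m V x,
      massInner m (t⁻¹ • position m V x t - v) (t⁻¹ • position m V x t - v) < ρ := by
  obtain ⟨hV, ε, hε, hLR⟩ := hV
  obtain ⟨t₀, ht₀, ht₀T⟩ := exists_pos_lt_escapeTime (m := m) hV hx
  have hε' : 0 < min ε (1 / 2) := lt_min hε (by norm_num)
  obtain ⟨K, hK, hmax⟩ := exists_correction (d := d) hm hV hε'
    ((min_le_right _ _).trans_lt (by norm_num)) (min_le_left _ _) hLR ht₀ hℓ0 (norm_nonneg v)
  set φ := correction K (min ε (1 / 2)) with hφ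
  obtain ⟨l, hl⟩ := tendsto_correction (m := m) hV hx K hε'
  set Q : ℝ → Config n d := fun t => t⁻¹ • position m V x t with hQ
  set e : ℝ → ℝ := fun t => massInner m (Q t - v) (Q t - v) with he
  -- Since `‖Q t‖²` converges, `⟨v, Q t⟩` is large exactly when `Q t` is close to `v`.
  have he' (t : ℝ) : 2 * massInner m v (Q t) =
      massInner m (Q t) (Q t) + massInner m v v - e t := by
    simp only [he, massInner_sub_left, massInner_sub_right]
    rw [massInner_comm (Q t) v]
    ring
  by_contra hcon
  have hfr : ∃ᶠ t in toEscape m V x, ρ ≤ e t :=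
    (not_eventually.1 hcon).mono fun t ht => not_lt.1 ht
  have hfe : ∃ᶠ t in toEscape m V x, e t < ρ / 8 :=
    hv.frequently (eventually_massInner_sub_self_lt v (by linarith))
  have hev : ∀ᶠ t in toEscape m V x, (t₀ < t ∧ t ∈ lifetime m V x) ∧
      (l - ρ / 8 < φ t ∧ φ t < l + ρ / 8) ∧
      (massInner m v v - ρ / 8 < massInner m (Q t) (Q t) ∧
        massInner m (Q t) (Q t) < massInner m v v + ρ / 8) :=
    (eventually_toEscape hV hx ht₀.le ht₀T).and
      ((hl.eventually (Ioo_mem_nhds (by linarith) (by linarith))).and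
        (hS.eventually (Ioo_mem_nhds (by linarith) (by linarith))))
  -- Times `a < s < b`, far from `v` at the ends and close at `s`, which force an interior maximum
  -- of the functional.
  obtain ⟨a, hea, ⟨⟨ha0, hal⟩, -⟩, hall⟩ := (hfr.and_eventually
    (hev.and (eventually_forall_ge_toEscape hV hx hev))).exists
  obtain ⟨s, hes, has, hsl⟩ := (hfe.and_eventually
    (eventually_toEscape hV hx (ht₀.trans ha0).le (lt_escapeTime_of_mem_lifetime hal))).exists
  obtain ⟨b, heb, hsb, hbl⟩ := (hfr.and_eventually
    (eventually_toEscape hV hx (ht₀.trans (ha0.trans has)).le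
      (lt_escapeTime_of_mem_lifetime hsl))).exists
  have hlife : ∀ t ∈ Icc a b, t ∈ lifetime m V x ∧ 0 < t := fun t ht =>
    have ht0 : 0 < t := ht₀.trans (ha0.trans_le ht.1)
    ⟨mem_lifetime_of_mem_uIcc hbl (mem_uIcc_of_le ht0.le ht.2), ht0⟩
  obtain ⟨t, ht, htmax⟩ := isCompact_Icc.exists_isMaxOn (nonempty_Icc.2 (has.trans hsb).le)
    (f := fun u => massInner m v (u⁻¹ • position m V x u) + φ u)
    fun u hu => (hasDerivAt_massInner_scaled hV (hlife u hu).1 (hlife u hu).2 v K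
      _).continuousAt.continuousWithinAt
  have hts : massInner m v (Q s) + φ s ≤ massInner m v (Q t) + φ t := htmax ⟨has.le, hsb.le⟩
  obtain ⟨htl, ht0⟩ := hlife t ht
  obtain ⟨⟨htt₀, -⟩, ⟨-, h1⟩, -, h1'⟩ := hall t htl ht.1
  obtain ⟨-, ⟨h2, -⟩, h2', -⟩ := hall s hsl has.le
  -- The errors add up to `ρ/8 + ρ/4 + ρ/2 < ρ`, from `e s`, the norms and the correction. So the
  -- maximum lies in the ball where particles with distinct `v i` are still separated.
  have het : e t < ρ := by
    linarith [he' t, he' s]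
  have hta : a < t := lt_of_le_of_ne ht.1 fun h => absurd hea (not_le.2 (h ▸ het))
  have htb : t < b := lt_of_le_of_ne ht.2 fun h => absurd heb (not_le.2 (h ▸ het))
  refine hmax x t htl htt₀.le v (fun i => norm_le_pi_norm v i) (fun i j hij => ?_)
    (htmax.isLocalMax (Icc_mem_nhds hta htb))
  have h5 := norm_sub_lt_of_massInner_lt hm hm₀' hm₀ (half_pos hℓ0) (het.trans_le hρ) i
  have h6 := norm_sub_lt_of_massInner_lt hm hm₀' hm₀ (half_pos hℓ0) (het.trans_le hρ) j
  have h7 : ‖v i - v j‖ ≤ ‖Q t i - v i‖ + ‖Q t i - Q t j‖ + ‖Q t j - v j‖ := by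
    rw [norm_sub_rev (Q t i) (v i)]
    have : v i - v j = (v i - Q t i) + (Q t i - Q t j) + (Q t j - v j) := by abel
    rw [this]
    exact norm_add₃_le
  have h8 : ℓ ≤ ‖Q t i - Q t j‖ := by linarith [hℓ i j hij]
  simp only [hQ, Pi.smul_apply] at h8
  rw [← smul_sub, norm_smul, norm_inv, Real.norm_of_nonneg ht0.le] at h8
  calc ℓ * t ≤ t⁻¹ * ‖position m V x t i - position m V x t j‖ * t := by gcongr
    _ = _ := by field_simp

/-- If the limit of `J(q(t,x)/t)` is finite, then the asymptotic velocity exists. -/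
lemma exists_tendsto_scaledPosition (hm : ∀ i, 0 < m i) (hV : IsLongRanged V)
    (hx : x ∈ phaseSpace n d) {L : ENNReal} (hL : L ≠ ⊤)
    (h : Tendsto (scaledInertia m V x) (toEscape m V x) (𝓝 L)) :
    ∃ v : Config n d, Tendsto (fun t : ℝ => t⁻¹ • position m V x t) (toEscape m V x) (𝓝 v) := by
  obtain ⟨m₀, hm₀', hm₀⟩ := exists_mass_lower_bound hm
  have hS : Tendsto (fun t : ℝ => massInner m (t⁻¹ • position m V x t) (t⁻¹ • position m V x t))
      (toEscape m V x) (𝓝 (2 * L.toReal)) := by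
    refine (((ENNReal.tendsto_toReal hL).comp h).const_mul 2).congr fun t => ?_
    have h2 := massInner_self_nonneg hm (t⁻¹ • position m V x t)
    simp only [Function.comp, scaledInertia]
    rw [ENNReal.toReal_ofReal (by rw [inertia_eq]; linarith), inertia_eq]
    ring
  obtain ⟨v, hvL, hv⟩ := exists_mapClusterPt_scaledPosition hm hV.contDiffOn hx hS
  obtain ⟨ℓ, hℓ0, hℓ⟩ := exists_separation v
  refine ⟨v, tendsto_pi_nhds.2 fun i => Metric.tendsto_nhds.2 fun c hc => ?_⟩
  filter_upwards [eventually_massInner_sub_lt hm hV hx (hvL ▸ hS) hv hm₀' hm₀ hℓ0 hℓ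
    (ρ := min (m₀ * (ℓ / 2) ^ 2) (m₀ * c ^ 2)) (lt_min (by positivity) (by positivity))
    (min_le_left _ _)] with t ht
  rw [dist_eq_norm]
  exact norm_sub_lt_of_massInner_lt hm hm₀' hm₀ hc (ht.trans_le (min_le_right _ _)) i

end Limits

/-! ### `NAV` as the set where `j⁺` is infinite, and its consequences. -/

variable {x : Phase n d}

lemma tendsto_jPlus (hm : ∀ i, 0 < m i) (hV : IsLongRanged V) (hx : x ∈ phaseSpace n d) :
    Tendsto (scaledInertia m V x) (toEscape m V x) (𝓝 (jPlus m V x)) :=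
  tendsto_nhds_limUnder (exists_tendsto_scaledInertia hm hV hx)

lemma mem_NAV_iff (hm : ∀ i, 0 < m i) (hV : IsLongRanged V) :
    x ∈ NAV m V ↔ x ∈ phaseSpace n d ∧ jPlus m V x = ⊤ := by
  refine and_congr_right fun hx => ⟨fun h => ?_, fun h => ?_⟩
  · by_contra hL
    exact h (exists_tendsto_scaledPosition hm hV hx hL (tendsto_jPlus hm hV hx))
  · rintro ⟨v, hv⟩
    have hne := toEscape_neBot (m := m) hV.contDiffOn hx
    have hc : Continuous fun q : Config n d => ENNReal.ofReal (inertia m q) := by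
      unfold inertia
      exact ENNReal.continuous_ofReal.comp (by fun_prop)
    have h1 : Tendsto (scaledInertia m V x) (toEscape m V x) (𝓝 (ENNReal.ofReal (inertia m v))) :=
      (hc.tendsto v).comp hv
    have h2 := tendsto_nhds_unique h1 (tendsto_jPlus hm hV hx)
    exact ENNReal.ofReal_ne_top (h2.trans h)

lemma tendsto_sqrt_massInner (hm : ∀ i, 0 < m i) (hV : IsLongRanged V) (hx : x ∈ NAV m V) :
    Tendsto (fun t : ℝ => √(massInner m (t⁻¹ • position m V x t) (t⁻¹ • position m V x t)))
      (toEscape m V x) atTop := by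
  obtain ⟨hxP, htop⟩ := (mem_NAV_iff hm hV).1 hx
  have h := tendsto_jPlus hm hV hxP
  rw [htop] at h
  have h1 := (ENNReal.tendsto_ofReal_nhds_top.1 h).const_mul_atTop (two_pos (α := ℝ))
  refine Real.tendsto_sqrt_atTop.comp (h1.congr fun t => ?_)
  rw [inertia_eq]
  ring

lemma tendsto_correctedNorm (hm : ∀ i, 0 < m i) (hV : IsLongRanged V) (hx : x ∈ NAV m V)
    {δ : ℝ} (hδ : 0 < δ) (μ K : ℝ) {ε : ℝ} (hε : 0 < ε) :
    Tendsto (correctedNorm m V δ μ K ε x) (toEscape m V x) atTop := by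
  obtain ⟨l, hl⟩ := tendsto_correction (m := m) hV.contDiffOn hx.1 K hε
  exact (tendsto_atTop_mono (fun t => sqrt_massInner_le_grafNorm hm hδ _)
    (tendsto_sqrt_massInner hm hV hx)).atTop_add hl

/-- Half the threshold in `IsMaxClustering.lt_norm_sub`; it depends on the masses alone. -/
lemma exists_clustering_parameter (hm : ∀ i, 0 < m i) {m₀ : ℝ} (hm₀ : 0 < m₀) :
    ∃ δ₀ : ℝ, 0 < δ₀ ∧ δ₀ ≤ 1 ∧ ∀ δ ≤ δ₀, δ * (m₀ + 16 * ∑ i, m i) < m₀ := by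
  have hM : 0 ≤ ∑ l, m l := Finset.sum_nonneg fun l _ => (hm l).le
  have h1 : m₀ / (m₀ + 16 * ∑ i, m i) / 2 * (m₀ + 16 * ∑ i, m i) = m₀ / 2 := by field_simp
  refine ⟨m₀ / (m₀ + 16 * ∑ i, m i) / 2, by positivity, ?_, fun δ hδ => ?_⟩
  · have h2 : m₀ / (m₀ + 16 * ∑ i, m i) ≤ 1 := div_le_one_of_le₀ (by linarith) (by positivity)
    linarith
  · calc δ * (m₀ + 16 * ∑ i, m i) ≤ m₀ / (m₀ + 16 * ∑ i, m i) / 2 * (m₀ + 16 * ∑ i, m i) := by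
          gcongr
      _ < m₀ := by rw [h1]; linarith

lemma correction_nonpos {K : ℝ} (hK : 0 ≤ K) (ε : ℝ) {t : ℝ} (ht : 0 ≤ t) :
    correction K ε t ≤ 0 :=
  neg_nonpos.2 (mul_nonneg hK (Real.rpow_nonneg ht _))

/-- Orbits starting near a point of `NAV` stay far out from some time on. -/
lemma exists_eventually_le_massInner (hm : ∀ i, 0 < m i) (hV : IsLongRanged V)
    (hx : x ∈ NAV m V) {t₀ : ℝ} (ht₀ : 0 < t₀) (ht₀T : (t₀ : EReal) < escapeTime m V x) (R : ℝ) :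
    ∃ t₁ : ℝ, t₀ < t₁ ∧ (t₁ : EReal) < escapeTime m V x ∧
      ∀ᶠ y in 𝓝 x, y ∈ phaseSpace n d ∧ t₁ ∈ lifetime m V y ∧ ∀ t ∈ lifetime m V y, t₁ ≤ t →
        R ≤ massInner m (t⁻¹ • position m V y t) (t⁻¹ • position m V y t) := by
  have hV' := hV.contDiffOn
  obtain ⟨ε, hε, hLR⟩ := hV.decay
  obtain ⟨m₀, hm₀', hm₀⟩ := exists_mass_lower_bound hm
  obtain ⟨δ, hδ0, hδ1, hδ⟩ := exists_clustering_parameter hm hm₀'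
  have hε' : 0 < min ε (1 / 2) := lt_min hε (by norm_num)
  obtain ⟨K, hK, hqc⟩ := exists_quasiconvex_correctedNorm (d := d) hm hV' hε'
    ((min_le_right _ _).trans_lt (by norm_num)) (min_le_left _ _) hLR hm₀' hm₀ hδ0
    (hδ δ le_rfl) one_pos ht₀
  have hcont {t : ℝ} (ht : t ∈ lifetime m V x) :
      ContinuousAt (fun y => correctedNorm m V δ 1 K (min ε (1 / 2)) y t) x := by
    have h1 : ContinuousAt (fun y => t⁻¹ • position m V y t) x :=
      (continuousAt_flow hV' hx.1 ht).2.snd.const_smul t⁻¹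
    exact (continuous_grafNorm.continuousAt.comp h1).add continuousAt_const
  have hne := toEscape_neBot (m := m) hV' hx.1
  -- At `t₁` the corrected norm beats its value at `t₀`. This persists for nearby `y`, and
  -- quasi-convexity on `[t₀, t]` then keeps the value at `t` above that at `t₁`. The `2` is the
  -- error `2μ` for `μ = 1`.
  obtain ⟨t₁, ht₁, ht₀₁, ht₁l⟩ := (((tendsto_correctedNorm hm hV hx hδ0 1 K hε').eventually
    (eventually_gt_atTop
      (max (correctedNorm m V δ 1 K (min ε (1 / 2)) x t₀) (√|R| + 2)))).and
    (eventually_toEscape hV' hx.1 ht₀.le ht₀T)).exists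
  have ht₀l : t₀ ∈ lifetime m V x := mem_lifetime_of_nonneg ht₀.le ht₀T
  refine ⟨t₁, ht₀₁, lt_escapeTime_of_mem_lifetime ht₁l, ?_⟩
  filter_upwards [isOpen_phaseSpace.mem_nhds hx.1, (continuousAt_flow hV' hx.1 ht₁l).1,
    (hcont ht₀l).eventually_lt (hcont ht₁l) ((le_max_left _ _).trans_lt ht₁),
    continuousAt_const.eventually_lt (hcont ht₁l) ((le_max_right _ _).trans_lt ht₁)]
    with y hyP hyl hy1 hy2
  refine ⟨hyP, hyl, fun t ht htt => ?_⟩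
  have h1 := hqc y t₀ t le_rfl ht t₁ ⟨ht₀₁.le, htt⟩
  have h2 := (le_max_iff.1 h1).resolve_left (not_le.2 hy1)
  have h3 := grafNorm_le hm hδ0 hδ1 one_pos (t⁻¹ • position m V y t)
  have h4 := correction_nonpos hK.le (min ε (1 / 2)) (ht₀.le.trans (ht₀₁.le.trans htt))
  have h5 : √|R| ≤ √(massInner m (t⁻¹ • position m V y t) (t⁻¹ • position m V y t)) := by
    have h6 : correctedNorm m V δ 1 K (min ε (1 / 2)) y t =
      grafNorm m δ 1 (t⁻¹ • position m V y t) + correction K (min ε (1 / 2)) t := rfl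
    linarith
  exact (le_abs_self R).trans
    ((Real.sqrt_le_sqrt_iff (massInner_self_nonneg hm _)).1 h5)

lemma deriv_nonneg_of_left_max {h : ℝ → ℝ} {h' a t : ℝ} (hh : HasDerivAt h h' t) (hat : a < t)
    (hle : ∀ u ∈ Icc a t, h u ≤ h t) : 0 ≤ h' := by
  have h1 := (hasDerivAt_iff_tendsto_slope.1 hh).mono_left
    (nhdsWithin_mono t fun u (hu : u ∈ Iio t) => hu.ne)
  refine ge_of_tendsto h1 ?_
  filter_upwards [Ioo_mem_nhdsLT hat] with u hu
  rw [slope_def_field]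
  exact div_nonneg_of_nonpos (by linarith [hle u ⟨hu.1.le, hu.2.le⟩]) (by linarith [hu.2])

/-- Divergence of the cluster-external velocity for the clusterings that are maximal at a fixed
scale. -/
lemma eventually_le_massInner_extProj_velocity (hm : ∀ i, 0 < m i) (hV : IsLongRanged V)
    (hx : x ∈ NAV m V) {m₀ : ℝ} (hm₀' : 0 < m₀) (hm₀ : ∀ i, m₀ ≤ m i) {δ μ : ℝ} (hδ0 : 0 < δ)
    (hδ1 : δ ≤ 1) (hδ : δ * (m₀ + 16 * ∑ i, m i) < m₀) (hμ : 0 < μ) (R : ℝ) :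
    ∀ᶠ t in toEscape m V x, ∀ B, IsMaxClustering m δ μ (t⁻¹ • position m V x t) B →
      R ≤ massInner m (extProj m B (velocity m V x t)) (extProj m B (velocity m V x t)) := by
  have hV' := hV.contDiffOn
  obtain ⟨ε, hε, hLR⟩ := hV.decay
  have hε' : 0 < min ε (1 / 2) := lt_min hε (by norm_num)
  obtain ⟨t₀, ht₀, ht₀T⟩ := exists_pos_lt_escapeTime (m := m) hV' hx.1
  obtain ⟨K, hK, hqc⟩ := exists_quasiconvex_correctedNorm (d := d) hm hV' hε'
    ((min_le_right _ _).trans_lt (by norm_num)) (min_le_left _ _) hLR hm₀' hm₀ hδ0 hδ hμ ht₀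
  set ε' := min ε (1 / 2) with hε'_def
  set D := K * ε' * t₀ ^ (-ε') with hD
  have hD0 : 0 < D := by positivity
  filter_upwards [eventually_toEscape hV' hx.1 ht₀.le ht₀T,
    (tendsto_correctedNorm hm hV hx hδ0 μ K hε').eventually
      (eventually_ge_atTop (correctedNorm m V δ μ K ε' x t₀)),
    (tendsto_sqrt_massInner hm hV hx).eventually
      (eventually_ge_atTop (2 * D + (|R| + 2 * μ ^ 2 + 1)))] with t ⟨htt, htl⟩ hg hS B hB
  have ht0 : 0 < t := ht₀.trans htt
  set q := t⁻¹ • position m V x t with hq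
  set v := velocity m V x t with hv
  set N := grafNorm m δ μ q with hN
  have hN0 : 0 < N := grafNorm_pos hm hδ0 hμ _
  set y := N⁻¹ • extProj m B q with hy
  obtain ⟨hle, heq⟩ := support_correctedNorm hm hδ0 hμ K ε' hB hN hy rfl
  -- By quasi-convexity the corrected norm on `[t₀, t]` is largest at `t`, hence so is the
  -- functional touching it there from below.
  have hder := deriv_nonneg_of_left_max (hasDerivAt_massInner_scaled hV' htl ht0 y K ε') htt
    fun u hu => by
      have h1 := hqc x t₀ t le_rfl htl u hu
      rw [max_eq_right hg] at h1
      linarith [hle u]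
  have h1 : 0 ≤ t * massInner m y v - massInner m y (position m V x t) + K * ε' * t ^ (1 - ε') :=
    nonneg_of_mul_nonneg_right hder (by positivity)
  have h2 : massInner m y (position m V x t) = t * massInner m y q := by
    rw [hq, massInner_smul_right]
    field_simp
  have h3 : t ^ (1 - ε') = t * t ^ (-ε') := by
    rw [show 1 - ε' = 1 + -ε' by ring, Real.rpow_add ht0, Real.rpow_one]
  have h4 : t ^ (-ε') ≤ t₀ ^ (-ε') :=
    Real.rpow_le_rpow_of_nonpos ht₀ htt.le (by linarith)
  have h5 : massInner m y q - D ≤ massInner m y v := by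
    have h6 : 0 ≤ t * (massInner m y v - massInner m y q + K * ε' * t ^ (-ε')) := by
      rw [h2, h3] at h1
      linarith
    have h7 := nonneg_of_mul_nonneg_right h6 ht0
    have h8 : K * ε' * t ^ (-ε') ≤ D := by rw [hD]; gcongr
    linarith
  set w := extProj m B q with hw
  have h6 : massInner m w q - N * D ≤ massInner m w v := by
    rw [hy, massInner_smul_left, massInner_smul_left] at h5
    have h7 := mul_le_mul_of_nonneg_left h5 hN0.le
    rw [mul_sub, mul_inv_cancel_left₀ hN0.ne', mul_inv_cancel_left₀ hN0.ne'] at h7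
    exact h7
  have h7 : massInner m w q = massInner m w w := by
    rw [massInner_comm, ← massInner_extProj_left hm (blockConst_extProj (m := m) B q) q]
  have h8 : massInner m w v = massInner m (extProj m B v) w := by
    rw [massInner_extProj_left hm (blockConst_extProj B q), massInner_comm]
  -- This gives `‖v^E‖² ≥ 2⟨v^E, w⟩ - ‖w‖² ≥ ‖w‖² - 2ND`, and `‖w‖²` differs from `N²` by at most
  -- `2μ²`.
  have h9 := massInner_self_nonneg hm (extProj m B v - w)
  simp only [massInner_sub_left, massInner_sub_right] at h9
  rw [massInner_comm w (extProj m B v)] at h9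
  have h10 : N ^ 2 = massInner m w w + 2 * μ ^ 2 * δ ^ B.parts.card := by
    rw [hN, hB.grafNorm_eq, Real.sq_sqrt (clusterWeight_pos hm hδ0 hμ _ _).le, clusterWeight]
  have h11 : 2 * μ ^ 2 * δ ^ B.parts.card ≤ 2 * μ ^ 2 * 1 :=
    mul_le_mul_of_nonneg_left (pow_le_one₀ hδ0.le hδ1) (by positivity)
  have h12 : 2 * D + (|R| + 2 * μ ^ 2 + 1) ≤ N := hS.trans (sqrt_massInner_le_grafNorm hm hδ0 q)
  have h13 : |R| + 2 * μ ^ 2 + 1 ≤ N * (N - 2 * D) := by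
    have h14 : 0 ≤ |R| + 2 * μ ^ 2 + 1 := by positivity
    have h15 : 1 ≤ N := by linarith [abs_nonneg R, sq_nonneg μ]
    nlinarith
  linarith [le_abs_self R]

/-- The external part of the kinetic energy diverges, so conservation of energy drives the potential
down. -/
lemma tendsto_potential (hm : ∀ i, 0 < m i) (hV : IsLongRanged V) (hx : x ∈ NAV m V) :
    Tendsto (fun t => potential V (position m V x t)) (toEscape m V x) atBot := by
  obtain ⟨m₀, hm₀', hm₀⟩ := exists_mass_lower_bound hm
  obtain ⟨δ, hδ0, hδ1, hδ⟩ := exists_clustering_parameter hm hm₀'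
  obtain ⟨t₀, ht₀, ht₀T⟩ := exists_pos_lt_escapeTime (m := m) hV.contDiffOn hx.1
  refine tendsto_atBot.2 fun b => ?_
  filter_upwards [eventually_le_massInner_extProj_velocity hm hV hx hm₀' hm₀ hδ0 hδ1 (hδ δ le_rfl)
    one_pos (2 * ((1 / 2) * massInner m (velocity m V x 0) (velocity m V x 0) +
        potential V (position m V x 0) - b)), eventually_toEscape hV.contDiffOn hx.1 ht₀.le ht₀T]
    with t ht ⟨htt, htl⟩
  obtain ⟨B, hB⟩ := exists_isMaxClustering m δ 1 (t⁻¹ • position m V x t)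
  have h1 := energy_eq hV.contDiffOn hm (ht₀.trans htt).le htl
  have h2 := massInner_extProj_le hm B (velocity m V x t)
  linarith [ht B hB]

lemma isMaxClustering_of_mem_grafCell {δ r : ℝ} {C : Clustering n} {q : Config n d} (hr : 0 < r)
    (h : r⁻¹ • q ∈ grafCell d m δ C) : IsMaxClustering m δ r q C := by
  intro C'
  have h1 : inertia m (extProj m C' (r⁻¹ • q)) + δ ^ C'.parts.card ≤
      inertia m (extProj m C (r⁻¹ • q)) + δ ^ C.parts.card := by
    rw [show inertia m (extProj m C (r⁻¹ • q)) + δ ^ C.parts.card = inertiaDelta m δ (r⁻¹ • q)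
      from h]
    exact le_ciSup (f := fun C : Clustering n =>
      inertia m (extProj m C (r⁻¹ • q)) + δ ^ C.parts.card) (finite_range _).bddAbove C'
  simp only [inertia_eq, extProj_smul, massInner_smul_left, massInner_smul_right] at h1
  have h2 := mul_le_mul_of_nonneg_left h1 (show 0 ≤ 2 * r ^ 2 by positivity)
  simp only [clusterWeight]
  field_simp at h2
  linarith

/-- In terms of `q/t`, the cluster function works at the shrinking scale `t^(-ε/2)`. After `t₀` its
clusterings refine those at the fixed scale `t₀^(-ε/2)`, and refinement can only increase the
external speed. -/
lemma tendsto_externalSpeed (hm : ∀ i, 0 < m i) (hV : IsLongRanged V) (hx : x ∈ NAV m V)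
    {m₀ : ℝ} (hm₀' : 0 < m₀) (hm₀ : ∀ i, m₀ ≤ m i) {δ ε : ℝ} (hε : 0 < ε) (hδ0 : 0 < δ)
    (hδ1 : δ ≤ 1) (hδ : δ * (m₀ + 16 * ∑ i, m i) < m₀) {A : ℝ → Clustering n}
    (hA : IsClusterFunction m V ε δ x A) :
    Tendsto (externalSpeed m V x A) (toEscape m V x) atTop := by
  obtain ⟨t₀, ht₀, ht₀T⟩ := exists_pos_lt_escapeTime (m := m) hV.contDiffOn hx.1
  refine tendsto_atTop.2 fun b => ?_
  filter_upwards [eventually_le_massInner_extProj_velocity hm hV hx hm₀' hm₀ hδ0 hδ1 hδ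
    (Real.rpow_pos_of_pos ht₀ (-(ε / 2))) (b ^ 2),
    eventually_toEscape hV.contDiffOn hx.1 ht₀.le ht₀T] with t ht ⟨htt, htl⟩
  have ht0 : 0 < t := ht₀.trans htt
  obtain ⟨B, hB⟩ := exists_isMaxClustering m δ (t₀ ^ (-(ε / 2))) (t⁻¹ • position m V x t)
  have h1 := hA t ht0 (lt_escapeTime_of_mem_lifetime htl)
  have h2 : (t ^ (1 - ε / 2))⁻¹ • position m V x t =
      (t ^ (-(ε / 2)))⁻¹ • t⁻¹ • position m V x t := by
    rw [smul_smul, ← mul_inv, show 1 - ε / 2 = -(ε / 2) + 1 by ring, Real.rpow_add ht0,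
      Real.rpow_one]
  rw [h2] at h1
  have h3 := isMaxClustering_of_mem_grafCell (Real.rpow_pos_of_pos ht0 _) h1
  have h4 := h3.refines hm hδ0 hm₀' hm₀ hδ (Real.rpow_pos_of_pos ht0 _)
    (Real.rpow_lt_rpow_of_neg ht₀ htt (by linarith)) hB
  have h5 := massInner_extProj_le_of_refines hm h4 (velocity m V x t)
  rw [externalSpeed, (hasDerivAt_extProj (hasDerivAt_position hV.contDiffOn htl)).deriv,
    massNorm_eq]
  exact Real.le_sqrt_of_sq_le ((ht B hB).trans h5)

/-- The value at `x` is `∞`, so lower bounds on `j⁺` near `x` suffice. -/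
lemma continuousAt_jPlus (hm : ∀ i, 0 < m i) (hV : IsLongRanged V) (hx : x ∈ NAV m V) :
    ContinuousAt (jPlus m V) x := by
  obtain ⟨t₀, ht₀, ht₀T⟩ := exists_pos_lt_escapeTime (m := m) hV.contDiffOn hx.1
  rw [ContinuousAt, ((mem_NAV_iff hm hV).1 hx).2, ENNReal.tendsto_nhds_top_iff_nnreal]
  intro R
  obtain ⟨t₁, h01, -, h⟩ := exists_eventually_le_massInner hm hV hx ht₀ ht₀T (2 * (R + 1))
  filter_upwards [h] with y ⟨hyP, hyl, hy⟩
  have hne := toEscape_neBot (m := m) hV.contDiffOn hyP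
  have h1 : ENNReal.ofReal (R + 1) ≤ jPlus m V y := by
    refine ge_of_tendsto (tendsto_jPlus hm hV hyP) ?_
    filter_upwards [eventually_toEscape hV.contDiffOn hyP (ht₀.trans h01).le
      (lt_escapeTime_of_mem_lifetime hyl)] with t ⟨htt, htl⟩
    refine ENNReal.ofReal_le_ofReal ?_
    rw [inertia_eq]
    linarith [hy t htl htt.le]
  refine lt_of_lt_of_le ?_ h1
  rw [ENNReal.lt_ofReal_iff_toReal_lt ENNReal.coe_ne_top, ENNReal.coe_toReal]
  linarith

lemma NAV_subset_Wand (hm : ∀ i, 0 < m i) (hV : IsLongRanged V) : NAV m V ⊆ Wand m V := by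
  intro x hx
  obtain ⟨t₀, ht₀, ht₀T⟩ := exists_pos_lt_escapeTime (m := m) hV.contDiffOn hx.1
  set R₀ := massInner m x.2 x.2 + 1 with hR₀
  have hR₀0 : 0 < R₀ := by linarith [massInner_self_nonneg hm x.2]
  obtain ⟨t₁, h01, h1T, h⟩ := exists_eventually_le_massInner hm hV hx ht₀ ht₀T (R₀ / t₀ ^ 2)
  have hc : Continuous fun y : Phase n d => massInner m y.2 y.2 :=
    continuous_massInner.comp (continuous_snd.prodMk continuous_snd)
  have hR : ∀ᶠ y in 𝓝 x, massInner m y.2 y.2 < R₀ :=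
    hc.continuousAt.eventually_lt continuousAt_const (by linarith)
  refine ⟨hx.1, _, h.and hR, fun y hy => hy.1.1, t₁, ht₀.trans h01, h1T, ?_⟩
  refine eq_empty_of_forall_notMem ?_
  rintro _ ⟨⟨-, hz⟩, ⟨t, y⟩, ⟨⟨ht, hy⟩, hD⟩, rfl⟩
  have htl : t ∈ lifetime m V y := mem_lifetime_of_mem_flowDomain hD
  have h1 := hy.1.2.2 t htl ht.1.le
  have ht0 : t₀ < t := h01.trans ht.1
  rw [massInner_smul_left, massInner_smul_right, div_le_iff₀ (by positivity)] at h1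
  change massInner m (position m V y t) (position m V y t) < R₀ at hz
  have h2 : t⁻¹ * (t⁻¹ * massInner m (position m V y t) (position m V y t)) * t₀ ^ 2 =
      (t₀ / t) ^ 2 * massInner m (position m V y t) (position m V y t) := by
    field_simp
  have h3 : (t₀ / t) ^ 2 ≤ 1 :=
    pow_le_one₀ (div_nonneg ht₀.le (ht₀.trans ht0).le) (div_le_one_of_le₀ ht0.le (ht₀.trans ht0).le)
  have h4 := massInner_self_nonneg hm (position m V y t)
  rw [h2] at h1
  nlinarith

lemma measurableSet_NAV (hm : ∀ i, 0 < m i) (hV : IsLongRanged V) :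
    MeasurableSet (NAV m V) := by
  -- Continuity of `j⁺` is available only at `NAV`, so superlevel sets are replaced by their
  -- interiors, which still contain `NAV`.
  have h : NAV m V = ⋂ k : ℕ, interior {y | y ∈ phaseSpace n d ∧ (k : ENNReal) < jPlus m V y} := by
    ext x
    rw [mem_iInter]
    refine ⟨fun hx k => mem_interior_iff_mem_nhds.2 ?_, fun hx => (mem_NAV_iff hm hV).2
      ⟨(interior_subset (hx 0)).1, ENNReal.eq_top_of_forall_nnreal_le fun r => ?_⟩⟩
    · refine (isOpen_phaseSpace.eventually_mem hx.1).and
        (continuousAt_const.eventually_lt (continuousAt_jPlus hm hV hx) ?_)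
      rw [((mem_NAV_iff hm hV).1 hx).2]
      exact ENNReal.natCast_lt_top k
    · obtain ⟨k, hk⟩ := exists_nat_gt r
      exact le_trans (by exact_mod_cast hk.le) (interior_subset (hx k)).2.le
  rw [h]
  exact MeasurableSet.iInter fun k => isOpen_interior.measurableSet

end NBody

theorem mainTheorem2 (n d : ℕ) (m : Fin n → ℝ) (hm : ∀ i, 0 < m i)
    (V : NBody.PairPotential n d) (hV : NBody.IsLongRanged V) :
    -- 1. the cluster-external speed diverges, and the potential tends to minus infinity
    (∃ δ₀ : ℝ, 0 < δ₀ ∧ δ₀ ≤ 1 ∧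
      ∀ ε : ℝ, 0 < ε → NBody.LongRangedWith V ε →
      ∀ δ : ℝ, 0 < δ → δ ≤ δ₀ →
      ∀ x ∈ NBody.NAV m V, ∀ A : ℝ → NBody.Clustering n,
        NBody.IsClusterFunction m V ε δ x A →
        Tendsto (NBody.externalSpeed m V x A) (NBody.toEscape m V x) atTop) ∧
    (∀ x ∈ NBody.NAV m V,
      Tendsto (fun t : ℝ => NBody.potential V (NBody.position m V x t))
        (NBody.toEscape m V x) atBot) ∧
    -- 2. the limit defining `j⁺` exists on the phase space, and `j⁺` is continuous at `NAV`
    (∀ x ∈ NBody.phaseSpace n d,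
      Tendsto (NBody.scaledInertia m V x) (NBody.toEscape m V x) (𝓝 (NBody.jPlus m V x))) ∧
    (∀ x ∈ NBody.NAV m V,
      ContinuousWithinAt (NBody.jPlus m V) (NBody.phaseSpace n d) x) ∧
    -- 3. `NAV` is wandering and Borel
    NBody.NAV m V ⊆ NBody.Wand m V ∧
    MeasurableSet (NBody.NAV m V) := by
  obtain ⟨m₀, hm₀', hm₀⟩ := NBody.exists_mass_lower_bound hm
  obtain ⟨δ₀, hδ₀, hδ₀1, hδ⟩ := NBody.exists_clustering_parameter hm hm₀'
  refine ⟨⟨δ₀, hδ₀, hδ₀1, fun ε hε _ δ hδ0 hδδ₀ x hx A hA => ?_⟩, fun x hx => ?_, fun x hx => ?_,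
    fun x hx => ?_, NBody.NAV_subset_Wand hm hV, NBody.measurableSet_NAV hm hV⟩
  · exact NBody.tendsto_externalSpeed hm hV hx hm₀' hm₀ hε hδ0 (hδδ₀.trans hδ₀1) (hδ δ hδδ₀) hA
  · exact NBody.tendsto_potential hm hV hx
  · exact NBody.tendsto_jPlus hm hV hx
  · exact (NBody.continuousAt_jPlus hm hV hx).continuousWithinAt
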